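/- Let $\mathrm{qCat}_\infty$ be the simplicial category of quasi-categories, i.e. the full simplicial subcategory of the category $\mathrm{sSet}$ of simplicial sets (enriched over itself) on the quasi-categories. A vertex $t$ of a quasi-category $A$ is \emph{terminal} if for every $n\ge 1$ each map $\partial\Delta^n\to A$ sending the final vertex $n$ to $t$ extends along $\partial\Delta^n\hookrightarrow\Delta^n$; a functor (simplicial map) \emph{preserves terminal objects} if it sends terminal vertices to terminal vertices. Let $\mathrm{qCat}_{\emptyset\infty}\subseteq\mathrm{qCat}_\infty$ be the simplicial subcategory whose objects are the quasi-categories that have a terminal vertex and whose $n$-arrows are all those $n$-arrows of $\mathrm{qCat}_\infty$ each of whose vertices is a functor that preserves terminal objects. Let $\mathcal A$ be a small simplicial category. A \emph{weight} is a simplicial functor $W\colon\mathcal A\to\mathrm{sSet}$. It is \emph{projective cofibrant} if it is a retract, in the category of simplicial functors and simplicial natural transformations, of a weight $W'$ such that $\emptyset\to W'$ is a countable composite of pushouts of coproducts of maps $i\times\mathcal A(a,-)\colon X\times\mathcal A(a,-)\to Y\times\mathcal A(a,-)$, where $a\in\mathcal A$ and $i\colon X\hookrightarrow Y$ is a monomorphism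 of simplicial sets. For a simplicial category $\mathcal K$ and a simplicial functor $D\colon\mathcal A\to\mathcal K$, a \emph{$W$-weighted cone} with vertex $L\in\mathcal K$ is a simplicial natural transformation $\lambda\colon W\to\mathcal K(L,D-)$. It is a \emph{limit cone} if for every $K\in\mathcal K$ composition with $\lambda$ is an isomorphism from $\mathcal K(K,L)$ to the simplicial set of simplicial natural transformations $W\to\mathcal K(K,D-)$. \textbf{Theorem.} $\mathrm{qCat}_{\emptyset\infty}$ is closed in $\mathrm{qCat}_\infty$ under limits weighted by projective cofibrant weights. That is, let $\mathcal A$ be a small simplicial category, $W\colon\mathcal A\to\mathrm{sSet}$ a projective cofibrant weight and $D\colon\mathcal A\to\mathrm{qCat}_{\emptyset\infty}$ a simplicial functor. Then the $W$-weighted limit of $D$ in $\mathrm{qCat}_\infty$ exists; and for every $W$-weighted limit cone in $\mathrm{qCat}_\infty$ over $D$, with vertex $L$, the quasi-category $L$ has a terminal object, the cone lies in $\mathrm{qCat}_{\emptyset\infty}$, and it is a $W$-weighted limit cone in $\mathrm{qCat}_{\emptyset\infty}$. -/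

import Mathlib

open CategoryTheory Simplicial MonoidalCategory Opposite

universe u v w

noncomputable section

namespace SimplicialLimits

/-! ### Simplicially enriched categories and simplicial functors to simplicial sets -/

/-- The simplicial set of arrows between two objects of a simplicially enriched category. -/
abbrev Map {C : Type v} [EnrichedCategory SSet.{u} C] (X Y : C) : SSet.{u} :=
  EnrichedCategory.Hom X Y

/-- Currying for the self-enrichment of simplicial sets. -/
def curryEquiv (X K Y : SSet.{u}) : (K ⟶ Map X Y) ≃ (X ⊗ K ⟶ Y) :=
  FunctorToTypes.functorHomEquiv X K Y

lemma curryEquiv_comp {X K K' Y : SSet.{u}} (h : K' ⟶ K) (f : K ⟶ Map X Y) :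
    curryEquiv X K' Y (h ≫ f) = X ◁ h ≫ curryEquiv X K Y f := rfl

lemma curryEquiv_eId (X : SSet.{u}) :
    curryEquiv X _ X (eId SSet.{u} X) = (ρ_ X).hom := rfl

lemma curryEquiv_comp_eComp {X Y Z K L : SSet.{u}} (f : K ⟶ Map X Y) (g : L ⟶ Map Y Z) :
    curryEquiv X _ Z ((f ⊗ₘ g) ≫ eComp SSet.{u} X Y Z) =
      (α_ _ _ _).inv ≫ curryEquiv X _ Y f ▷ _ ≫ curryEquiv Y _ Z g := rfl

variable (A : Type u) [EnrichedCategory SSet.{u} A]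

/-- A weight on a small simplicially enriched category `A` is a simplicial functor from `A` to
simplicial sets. This type is given its own category structure below, because a simplicial
natural transformation has to be natural with respect to the arrows of `A` of every dimension,
and not only with respect to those of the underlying ordinary category. -/
structure Weight : Type (u + 1) where
  /-- The underlying simplicial functor. -/
  functor : EnrichedFunctor SSet.{u} A SSet.{u}

variable {A}

namespace Weight

/-- The value of a weight at an object. -/
abbrev obj (W : Weight A) (a : A) : SSet.{u} := W.functor.obj a

/-- The action of the simplicial functor `W` on arrows of all dimensions, in uncurried form. -/
def act (W : Weight A) (a b : A) : W.obj a ⊗ Map a b ⟶ W.obj b :=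
  curryEquiv _ _ _ (W.functor.map a b)

lemma act_id (W : Weight A) (a : A) :
    W.obj a ◁ eId SSet.{u} a ≫ W.act a a = (ρ_ _).hom := by
  rw [act, ← curryEquiv_comp, EnrichedFunctor.map_id, curryEquiv_eId]

lemma act_comp (W : Weight A) (a b c : A) :
    W.obj a ◁ eComp SSet.{u} a b c ≫ W.act a c =
      (α_ _ _ _).inv ≫ W.act a b ▷ _ ≫ W.act b c := by
  rw [act, ← curryEquiv_comp, EnrichedFunctor.map_comp, curryEquiv_comp_eComp]
  rfl

/-- The weight determined by an associative and unital action. -/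
def ofAction (obj : A → SSet.{u}) (act : ∀ a b, obj a ⊗ Map a b ⟶ obj b)
    (act_id : ∀ a, obj a ◁ eId SSet.{u} a ≫ act a a = (ρ_ _).hom)
    (act_comp : ∀ a b c, obj a ◁ eComp SSet.{u} a b c ≫ act a c =
      (α_ _ _ _).inv ≫ act a b ▷ _ ≫ act b c) : Weight A where
  functor :=
    { obj := obj
      map := fun a b => (curryEquiv _ _ _).symm (act a b)
      map_id := fun a => (curryEquiv _ _ _).injective (by
        rw [curryEquiv_comp, Equiv.apply_symm_apply, act_id, curryEquiv_eId])
      map_comp := fun a b c => (curryEquiv _ _ _).injective (by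
        rw [curryEquiv_comp, Equiv.apply_symm_apply, act_comp, curryEquiv_comp_eComp,
          Equiv.apply_symm_apply, Equiv.apply_symm_apply]) }

lemma ofAction_act (obj : A → SSet.{u}) (act : ∀ a b, obj a ⊗ Map a b ⟶ obj b)
    (act_id) (act_comp) (a b : A) : (ofAction obj act act_id act_comp).act a b = act a b :=
  Equiv.apply_symm_apply _ _

/-- A simplicial natural transformation between weights: a family of simplicial maps which
commutes with the action of the arrows of `A` of every dimension. -/
@[ext]
structure Hom (W W' : Weight A) where
  /-- The components. -/
  app (a : A) : W.obj a ⟶ W'.obj a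
  naturality (a b : A) : W.act a b ≫ app b = app a ▷ Map a b ≫ W'.act a b

/-- Weights on `A`, with simplicial natural transformations. -/
instance : Category.{u} (Weight A) where
  Hom := Hom
  id W := { app := fun a => 𝟙 _, naturality := fun a b => by simp }
  comp f g :=
    { app := fun a => f.app a ≫ g.app a
      naturality := fun a b => by
        rw [← Category.assoc, f.naturality, Category.assoc, g.naturality, comp_whiskerRight,
          Category.assoc] }
  id_comp f := Hom.ext (funext fun a => Category.id_comp (f.app a))
  comp_id f := Hom.ext (funext fun a => Category.comp_id (f.app a))
  assoc f g h := Hom.ext (funext fun a => Category.assoc (f.app a) (g.app a) (h.app a))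

/-- The covariant representable weight `b ↦ Map a b`. -/
def representable (a : A) : Weight A :=
  ofAction (fun b => Map a b) (fun b c => eComp SSet.{u} a b c)
    (fun b => by
      rw [← cancel_epi (ρ_ (Map a b)).inv, e_comp_id, Iso.inv_hom_id])
    (fun b c d => by rw [e_assoc])

/-- The tensor `X × W` of a weight with a simplicial set, formed objectwise. -/
def tensor (X : SSet.{u}) (W : Weight A) : Weight A :=
  ofAction (fun a => X ⊗ W.obj a) (fun a b => (α_ _ _ _).hom ≫ X ◁ W.act a b)
    (fun a => by simp [← MonoidalCategory.whiskerLeft_comp, act_id])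
    (fun a b c => by simp [← MonoidalCategory.whiskerLeft_comp, act_comp])

/-- The transformation `i × W : X × W ⟶ Y × W` induced by a simplicial map `i : X ⟶ Y`. -/
def tensorMap {X Y : SSet.{u}} (i : X ⟶ Y) (W : Weight A) : tensor X W ⟶ tensor Y W where
  app a := i ▷ W.obj a
  naturality a b := by
    simp only [tensor, ofAction_act]
    exact rfl

/-- The maps `i × Map a - : X × Map a - ⟶ Y × Map a -`, for `i : X ⟶ Y` a monomorphism of
simplicial sets and `a` an object of `A`. -/
inductive projectiveCells : MorphismProperty (Weight A) where
  | mk {X Y : SSet.{u}} (i : X ⟶ Y) [Mono i] (a : A) :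
    projectiveCells (tensorMap i (representable a))

/-- A weight is projective cofibrant if it is a retract of a weight `W'` for which the map
`∅ ⟶ W'` is a countable composite of pushouts of coproducts of maps `i × Map a -` with `i` a
monomorphism of simplicial sets. -/
def IsProjectiveCofibrant (W : Weight A) : Prop :=
  ∃ (E W' : Weight A) (_ : Limits.IsInitial E) (f : E ⟶ W'),
    (MorphismProperty.coproducts.{u}
      (projectiveCells (A := A))).pushouts.transfiniteCompositionsOfShape ℕ f ∧
    Nonempty (Retract W W')

end Weight

/-! ### Weighted limits in a simplicially enriched category -/

section

variable {C : Type v} [EnrichedCategory SSet.{u} C] {C' : Type w} [EnrichedCategory SSet.{u} C']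

/-- A `W`-weighted cone with vertex `L` over the diagram `D`: a simplicial natural transformation
from `W` to `Map L (D -)`. -/
@[ext]
structure WeightedCone (W : Weight A) (D : EnrichedFunctor SSet.{u} A C) (L : C) where
  /-- The components of the cone. -/
  app (a : A) : W.obj a ⟶ Map L (D.obj a)
  naturality (a b : A) :
    W.act a b ≫ app b = (app a ⊗ₘ D.map a b) ≫ eComp SSet.{u} L (D.obj a) (D.obj b)

namespace WeightedCone

variable {W : Weight A} {D : EnrichedFunctor SSet.{u} A C} {L : C}

/-- A weighted cone exhibits `L` as the limit of `D` weighted by `W` if composition with it is an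
isomorphism from `Map K L` to the simplicial set of simplicial natural transformations from `W`
to `Map K (D -)`, for every object `K`. This is expressed on maps out of an arbitrary simplicial
set `X`: maps `X ⟶ Map K L` correspond to transformations from `X × W` to `Map K (D -)`. -/
def IsLimit (c : WeightedCone W D L) : Prop :=
  ∀ (K : C) (X : SSet.{u}) (s : WeightedCone (Weight.tensor X W) D K),
    ∃! g : X ⟶ Map K L, ∀ a : A, (g ⊗ₘ c.app a) ≫ eComp SSet.{u} K L (D.obj a) = s.app a

/-- The image of a weighted cone under a simplicial functor. -/
def map (c : WeightedCone W D L) (G : EnrichedFunctor SSet.{u} C C') :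
    WeightedCone W (D.comp SSet.{u} G) (G.obj L) where
  app a := c.app a ≫ G.map L (D.obj a)
  naturality a b := by
    have h := c.naturality a b =≫ G.map L (D.obj b)
    rw [Category.assoc, Category.assoc, G.map_comp,
      MonoidalCategory.tensorHom_comp_tensorHom_assoc] at h
    exact h

end WeightedCone

end

/-! ### Quasi-categories with terminal objects -/

/-- The final vertex of the sphere `∂Δ[n + 1]`. -/
def boundaryLast (n : ℕ) : (∂Δ[n + 1] : SSet.{u}) _⦋0⦌ :=
  ⟨SSet.stdSimplex.obj₀Equiv.symm (Fin.last (n + 1)), by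
    rw [SSet.boundary_obj_eq_univ 0 (n + 1)]
    exact Set.mem_univ _⟩

/-- A vertex `t` is terminal if every sphere `∂Δ[n] ⟶ B`, `n ≥ 1`, which sends the final vertex
to `t` extends to a simplex `Δ[n] ⟶ B`. -/
def IsTerminalVertex (B : SSet.{u}) (t : B _⦋0⦌) : Prop :=
  ∀ (n : ℕ) (x : (∂Δ[n + 1] : SSet.{u}) ⟶ B), x.app _ (boundaryLast n) = t →
    ∃ y : Δ[n + 1] ⟶ B, ∂Δ[n + 1].ι ≫ y = x

/-- A functor preserves terminal objects if it sends terminal objects to terminal objects. -/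
def PreservesTerminal {B C : SSet.{u}} (f : B ⟶ C) : Prop :=
  ∀ t : B _⦋0⦌, IsTerminalVertex B t → IsTerminalVertex C (f.app _ t)

/-- The vertices of a simplex of `Map B C`, as functors `B ⟶ C`. -/
def mapVertex {B C : SSet.{u}} {n : SimplexCategoryᵒᵖ} (s : (Map B C).obj n)
    (i : n ⟶ op ⦋0⦌) : B ⟶ C :=
  (SimplicialCategory.homEquiv' B C).symm ((Map B C).map i s)

/-- The `n`-arrows from `B` to `C` all of whose vertices preserve terminal objects. -/
def terminalMap (B C : SSet.{u}) : (Map B C).Subcomplex where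
  obj n := Set.ofPred fun s => ∀ i : n ⟶ op ⦋0⦌, PreservesTerminal (mapVertex s i)
  map f s hs i := by
    have h : mapVertex ((Map B C).map f s) i = mapVertex s (f ≫ i) := by
      simp [mapVertex]
    rw [h]
    exact hs (f ≫ i)

/-- The objects of the simplicial category `QCatTerminal` are the quasi-categories which have a
terminal object. -/
structure QCatTerminal : Type (u + 1) where
  /-- The underlying quasi-category. -/
  toQCat : SSet.QCat.{u}
  exists_terminal : ∃ t : toQCat.obj _⦋0⦌, IsTerminalVertex toQCat.obj t

namespace QCatTerminal

lemma preservesTerminal_id (B : SSet.{u}) : PreservesTerminal (𝟙 B) := fun _ ht => ht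

lemma preservesTerminal_comp {B C E : SSet.{u}} {f : B ⟶ C} {g : C ⟶ E}
    (hf : PreservesTerminal f) (hg : PreservesTerminal g) : PreservesTerminal (f ≫ g) :=
  fun t ht => hg _ (hf t ht)

lemma mapVertex_eId (B : SSet.{u}) {n : SimplexCategoryᵒᵖ} (x : (𝟙_ SSet.{u}).obj n)
    (i : n ⟶ op ⦋0⦌) : mapVertex ((eId SSet.{u} B).app n x) i = 𝟙 B := by
  rw [mapVertex, Equiv.symm_apply_eq]
  rfl

lemma mapVertex_eComp {B C E : SSet.{u}} {n : SimplexCategoryᵒᵖ} (x : (Map B C ⊗ Map C E).obj n)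
    (i : n ⟶ op ⦋0⦌) :
    mapVertex ((eComp SSet.{u} B C E).app n x) i = mapVertex x.1 i ≫ mapVertex x.2 i := by
  obtain ⟨s, t⟩ := x
  obtain ⟨f, hf⟩ := (SimplicialCategory.homEquiv' B C).surjective ((Map B C).map i s)
  obtain ⟨g, hg⟩ := (SimplicialCategory.homEquiv' C E).surjective ((Map C E).map i t)
  have h : (Map B E).map i ((eComp SSet.{u} B C E).app n (s, t)) =
      (eComp SSet.{u} B C E).app _ ((Map B C).map i s, (Map C E).map i t) := rfl
  simp only [mapVertex]
  rw [h, ← hf, ← hg, Equiv.symm_apply_apply, Equiv.symm_apply_apply, Equiv.symm_apply_eq]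
  rfl

/-- Quasi-categories with terminal objects form a simplicial category, whose `n`-arrows are the
`n`-arrows of `SSet.QCat` all of whose vertices preserve terminal objects. -/
instance : EnrichedCategory SSet.{u} QCatTerminal.{u} where
  Hom B C := (terminalMap B.toQCat.obj C.toQCat.obj).toSSet
  id B := SSet.Subcomplex.lift (eId SSet.{u} B.toQCat.obj) (by
    rintro n _ ⟨x, rfl⟩ i
    rw [mapVertex_eId]
    exact preservesTerminal_id _)
  comp B C E := SSet.Subcomplex.lift
    (((terminalMap B.toQCat.obj C.toQCat.obj).ι ⊗ₘ (terminalMap C.toQCat.obj E.toQCat.obj).ι) ≫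
      eComp SSet.{u} B.toQCat.obj C.toQCat.obj E.toQCat.obj) (by
    rintro n _ ⟨x, rfl⟩ i
    have h := mapVertex_eComp ((x.1.1, x.2.1) :
      (Map B.toQCat.obj C.toQCat.obj ⊗ Map C.toQCat.obj E.toQCat.obj).obj n) i
    exact Eq.mpr (congrArg PreservesTerminal h) (preservesTerminal_comp (x.1.2 i) (x.2.2 i)))
  id_comp B C := by
    rw [← cancel_mono (terminalMap B.toQCat.obj C.toQCat.obj).ι]
    exact congrArg ((terminalMap B.toQCat.obj C.toQCat.obj).ι ≫ ·)
      (e_id_comp SSet.{u} B.toQCat.obj C.toQCat.obj)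
  comp_id B C := by
    rw [← cancel_mono (terminalMap B.toQCat.obj C.toQCat.obj).ι]
    exact congrArg ((terminalMap B.toQCat.obj C.toQCat.obj).ι ≫ ·)
      (e_comp_id SSet.{u} B.toQCat.obj C.toQCat.obj)
  assoc B C E F := by
    rw [← cancel_mono (terminalMap B.toQCat.obj F.toQCat.obj).ι]
    exact congrArg (((terminalMap B.toQCat.obj C.toQCat.obj).ι ⊗ₘ
      (terminalMap C.toQCat.obj E.toQCat.obj).ι ⊗ₘ
        (terminalMap E.toQCat.obj F.toQCat.obj).ι) ≫ ·)
      (e_assoc SSet.{u} B.toQCat.obj C.toQCat.obj E.toQCat.obj F.toQCat.obj)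

/-- The inclusion of the simplicial category of quasi-categories with terminal objects into the
simplicial category of quasi-categories. -/
def incl : EnrichedFunctor SSet.{u} QCatTerminal.{u} SSet.QCat.{u} where
  obj B := B.toQCat
  map B C := (terminalMap B.toQCat.obj C.toQCat.obj).ι
  map_id _ := rfl
  map_comp _ _ _ := rfl

end QCatTerminal

end SimplicialLimits

end

/-!
Regard a diagram `D` of quasi-categories with terminal vertices as a simplicial functor `E` to
simplicial sets. A weighted cone with vertex `L` over `D` is a map `L × W ⟶ E`, and it is a limit
cone if and only if this map has the universal property of a weighted limit in simplicial sets
(`isLimit_iff_isUniversal`). The limit `L` in simplicial sets exists, and maps `U ⟶ L` correspond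
to maps from `W` to the objectwise cotensor of `E` with `U`.

A projective cofibrant weight lifts against objectwise trivial fibrations
(`Weight.IsProjectiveCofibrant.exists_lift`). This is applied to three of them.

* Restriction along an inner horn inclusion is a trivial fibration on maps into a quasi-category.
  Hence `L` is a quasi-category (`Weight.IsUniversal.quasicategory`).
* The full simplicial subset on the terminal vertices of each `E a` is a contractible Kan complex.
  Hence `L` has a vertex whose components are terminal (`Weight.IsUniversal.exists_vertex`).
* Restriction from `Δ[n + 1]` to its boundary is a trivial fibration on the maps which send the
  last vertex to a terminal vertex, because a map extends along a monomorphism which is bijective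
  on vertices as soon as the new simplices end at terminal vertices (`exists_extension`). Hence the
  vertices of `L` with terminal components are terminal (`Weight.IsUniversal.isTerminalVertex`).

Conversely, a terminal vertex of `L` has terminal components
(`Weight.IsUniversal.isTerminalVertex_app`). It is a retract of the terminal vertex found above, as
any two terminal vertices are retracts of each other (`exists_retract`). So its components are
retracts of terminal vertices, and in a quasi-category such retracts are terminal
(`IsTerminalVertex.of_retract`). The last fact is proved by an explicit sequence of inner horn
extensions in `Δ[n + 3]`.

Thus a vertex of `L` is terminal if and only if its components are. One direction says that the
limit cone lies in `QCatTerminal`; the other one, that a map `X ⟶ Map K L` takes values in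
functors which preserve terminal vertices if its composites with the cone do, so that the cone is
a limit cone in `QCatTerminal`.
-/

noncomputable section

namespace SimplicialLimits

variable {A : Type u} [EnrichedCategory SSet.{u} A]

/-! ### Weights in terms of elements -/

/-- Restriction of maps along `j : U ⟶ V`. -/
def mapPre {U V : SSet.{u}} (j : U ⟶ V) (B : SSet.{u}) :
    Map V B ⟶ Map U B where
  app n := ↾fun φ =>
    { app := fun m i => j.app m ≫ φ.app m i
      naturality := fun {m m'} h i => by
        ext y
        have h₁ := congr($(Functor.HomObj.naturality φ h i) (j.app m y))
        have h₂ : V.map h (j.app m y) = j.app m' (U.map h y) := congr($(j.naturality h) y).symm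
        exact (congrArg _ h₂.symm).trans h₁ }
  naturality n m i := rfl

namespace Weight

lemma act_eId_apply (W : Weight A) (a : A) {n : SimplexCategoryᵒᵖ} (x : (W.obj a).obj n) :
    (W.act a a).app n (x, (eId SSet.{u} a).app n PUnit.unit) = x :=
  congr($(W.act_id a).app n (x, PUnit.unit))

lemma act_eComp_apply (W : Weight A) (a b c : A) {n : SimplexCategoryᵒᵖ} (x : (W.obj a).obj n)
    (k : (Map a b).obj n) (l : (Map b c).obj n) :
    (W.act a c).app n (x, (eComp SSet.{u} a b c).app n (k, l)) =
      (W.act b c).app n ((W.act a b).app n (x, k), l) :=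
  congr($(W.act_comp a b c).app n (x, (k, l)))

lemma act_map (W : Weight A) (a b : A) {n m : SimplexCategoryᵒᵖ} (i : n ⟶ m)
    (x : (W.obj a).obj n) (k : (Map a b).obj n) :
    (W.act a b).app m ((W.obj a).map i x, (Map a b).map i k) =
      (W.obj b).map i ((W.act a b).app n (x, k)) :=
  congr($((W.act a b).naturality i) (x, k))

lemma Hom.naturality_apply {W W' : Weight A} (f : W ⟶ W') (a b : A) {n : SimplexCategoryᵒᵖ}
    (x : (W.obj a).obj n) (k : (Map a b).obj n) :
    (f.app b).app n ((W.act a b).app n (x, k)) =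
      (W'.act a b).app n ((f.app a).app n x, k) :=
  congr($(f.naturality a b).app n (x, k))

@[ext]
lemma hom_ext {W W' : Weight A} {f g : W ⟶ W'} (h : ∀ a, f.app a = g.app a) : f = g :=
  Hom.ext (funext h)

lemma ofAction_act_apply (obj : A → SSet.{u}) (act : ∀ a b, obj a ⊗ Map a b ⟶ obj b)
    (act_id) (act_comp) (a b : A) {n : SimplexCategoryᵒᵖ} (x : (obj a ⊗ Map a b : SSet).obj n) :
    ((ofAction obj act act_id act_comp).act a b).app n x = (act a b).app n x :=
  congr($(ofAction_act obj act act_id act_comp a b).app n x)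

lemma tensor_act_apply (X : SSet.{u}) (W : Weight A) (a b : A) {n : SimplexCategoryᵒᵖ}
    (x : X.obj n) (y : (W.obj a).obj n) (k : (Map a b).obj n) :
    ((tensor X W).act a b).app n ((x, y), k) = (x, (W.act a b).app n (y, k)) :=
  ofAction_act_apply _ _ _ _ a b _

lemma representable_act_apply (a b c : A) {n : SimplexCategoryᵒᵖ}
    (k : (Map a b).obj n) (l : (Map b c).obj n) :
    ((representable a).act b c).app n (k, l) = (eComp SSet.{u} a b c).app n (k, l) :=
  ofAction_act_apply _ _ _ _ b c _

lemma functor_map_app_apply (W : Weight A) (a b : A) {n m : SimplexCategoryᵒᵖ}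
    (k : (Map a b).obj n) (i : n ⟶ m) (y : (W.obj a).obj m) :
    ((W.functor.map a b).app n k).app m i y = (W.act a b).app m (y, (Map a b).map i k) := by
  have h : (W.functor.map a b).app m ((Map a b).map i k) =
      (Map (W.obj a) (W.obj b)).map i ((W.functor.map a b).app n k) :=
    congr($((W.functor.map a b).naturality i) k)
  have h' : (W.act a b).app m (y, (Map a b).map i k) =
    ((W.functor.map a b).app m ((Map a b).map i k)).app m (𝟙 m) y := rfl
  rw [h', h]
  have h'' : ((Map (W.obj a) (W.obj b)).map i ((W.functor.map a b).app n k)).app m (𝟙 m) y =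
    ((W.functor.map a b).app n k).app m (i ≫ 𝟙 m) y := rfl
  rw [h'', Category.comp_id]

/-! ### Cotensors and the enriched Yoneda lemma -/

/-- The cotensor `Map U E` of a weight with a simplicial set, formed objectwise. -/
def cotensor (U : SSet.{u}) (E : Weight A) : Weight A :=
  ofAction (fun a => Map U (E.obj a))
    (fun a b => Map U (E.obj a) ◁ E.functor.map a b ≫ eComp SSet.{u} U _ _)
    (fun a => by
      rw [← Category.assoc, ← MonoidalCategory.whiskerLeft_comp, EnrichedFunctor.map_id,
        ← cancel_epi (ρ_ (Map U (E.obj a))).inv, e_comp_id, Iso.inv_hom_id])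
    (fun a b c => by
      rw [← Category.assoc, ← MonoidalCategory.whiskerLeft_comp, EnrichedFunctor.map_comp]
      rfl)

lemma cotensor_act_apply (U : SSet.{u}) (E : Weight A) (a b : A) {n m : SimplexCategoryᵒᵖ}
    (φ : (Map U (E.obj a)).obj n) (k : (Map a b).obj n) (i : n ⟶ m) (y : U.obj m) :
    (((cotensor U E).act a b).app n (φ, k)).app m i y =
      (E.act a b).app m (φ.app m i y, (Map a b).map i k) := by
  have h : ((cotensor U E).act a b).app n (φ, k) = (eComp SSet.{u} U _ _).app n
      (φ, (E.functor.map a b).app n k) := ofAction_act_apply _ _ _ _ a b _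
  rw [h, ← functor_map_app_apply]
  rfl

/-- Restriction of the objectwise cotensor along `j : U ⟶ V`. -/
def cotensorMap {U V : SSet.{u}} (j : U ⟶ V) (E : Weight A) : cotensor V E ⟶ cotensor U E where
  app a := mapPre j (E.obj a)
  naturality a b := by
    ext n ⟨φ, k⟩
    refine Functor.HomObj.ext (funext fun m => funext fun i => ?_)
    ext y
    exact (cotensor_act_apply V E a b φ k i (j.app m y)).trans
      (cotensor_act_apply U E a b ((mapPre j (E.obj a)).app n φ) k i y).symm

/-- Tensors and cotensors of weights with a simplicial set are adjoint. -/
def tensorHomEquiv (U : SSet.{u}) (W E : Weight A) :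
    (tensor U W ⟶ E) ≃ (W ⟶ cotensor U E) where
  toFun f :=
    { app := fun a => (curryEquiv U (W.obj a) (E.obj a)).symm (f.app a)
      naturality := fun a b => by
        ext n ⟨w, k⟩
        refine Functor.HomObj.ext (funext fun m => funext fun i => ?_)
        ext y
        refine Eq.trans ?_ (cotensor_act_apply U E a b
          (((curryEquiv U (W.obj a) (E.obj a)).symm (f.app a)).app n w) k i y).symm
        have h := Hom.naturality_apply f a b
          ((y, (W.obj a).map i w) : (U ⊗ W.obj a : SSet).obj m) ((Map a b).map i k)
        rw [tensor_act_apply, act_map] at h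
        exact h }
  invFun g :=
    { app := fun a => curryEquiv U (W.obj a) (E.obj a) (g.app a)
      naturality := fun a b => by
        ext n ⟨⟨y, w⟩, k⟩
        refine (congrArg ((curryEquiv U (W.obj b) (E.obj b) (g.app b)).app n)
          (tensor_act_apply U W a b y w k)).trans ?_
        have h := cotensor_act_apply U E a b ((g.app a).app n w) k (𝟙 n) y
        rw [← Hom.naturality_apply, (Map a b).map_id] at h
        exact h }
  left_inv f := hom_ext fun a => (curryEquiv _ _ _).apply_symm_apply _
  right_inv g := hom_ext fun a => (curryEquiv _ _ _).symm_apply_apply _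

/-- The enriched Yoneda lemma: maps `X × Map a - ⟶ E` correspond to maps `X ⟶ E a`. -/
def representableEquiv (X : SSet.{u}) (a : A) (E : Weight A) :
    (tensor X (representable a) ⟶ E) ≃ (X ⟶ E.obj a) where
  toFun f := (ρ_ X).inv ≫ X ◁ eId SSet.{u} a ≫ f.app a
  invFun u :=
    { app := fun b => u ▷ Map a b ≫ E.act a b
      naturality := fun b c => by
        ext n ⟨⟨x, k⟩, l⟩
        refine (congrArg ((u ▷ Map a c ≫ E.act a c).app n)
          ((tensor_act_apply X (representable a) b c x k l).trans
            (congrArg (Prod.mk x) (representable_act_apply a b c k l)))).trans ?_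
        exact act_eComp_apply E a b c (u.app n x) k l }
  left_inv f := hom_ext fun b => by
    ext n ⟨x, k⟩
    refine (Hom.naturality_apply f a b
      ((x, (eId SSet.{u} a).app n PUnit.unit) : (X ⊗ Map a a : SSet).obj n) k).symm.trans ?_
    exact congrArg ((f.app b).app n) ((tensor_act_apply X (representable a) a b x _ k).trans
      (congrArg (Prod.mk x) ((representable_act_apply a a b _ k).trans
        congr($(e_id_comp SSet.{u} a b).app n k))))
  right_inv u := by
    ext n x
    exact act_eId_apply E a (u.app n x)

lemma representableEquiv_tensorMap {X Y : SSet.{u}} (i : X ⟶ Y) (a : A) {E : Weight A}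
    (f : tensor Y (representable a) ⟶ E) :
    representableEquiv X a E (tensorMap i _ ≫ f) = i ≫ representableEquiv Y a E f := rfl

lemma representableEquiv_comp {X : SSet.{u}} (a : A) {E F : Weight A}
    (f : tensor X (representable a) ⟶ E) (p : E ⟶ F) :
    representableEquiv X a F (f ≫ p) = representableEquiv X a E f ≫ p.app a := rfl

lemma hasLiftingProperty_tensorMap_representable {X Y : SSet.{u}} (i : X ⟶ Y) (a : A)
    {E F : Weight A} (p : E ⟶ F) [HasLiftingProperty i (p.app a)] :
    HasLiftingProperty (tensorMap i (representable a)) p where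
  sq_hasLift {f g} sq := by
    have sq' : CommSq (representableEquiv X a E f) i (p.app a) (representableEquiv Y a F g) :=
      ⟨by rw [← representableEquiv_comp, sq.w, representableEquiv_tensorMap]⟩
    refine ⟨⟨(representableEquiv Y a E).symm sq'.lift, ?_, ?_⟩⟩
    · apply (representableEquiv X a E).injective
      rw [representableEquiv_tensorMap, Equiv.apply_symm_apply, sq'.fac_left]
    · apply (representableEquiv Y a F).injective
      rw [representableEquiv_comp, Equiv.apply_symm_apply, sq'.fac_right]

/-- Projective cofibrant weights lift against objectwise trivial fibrations. By the enriched Yoneda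
lemma the cells `i × Map a -` lift against them, and the lifting property passes to coproducts,
pushouts, countable composites and retracts. -/
lemma IsProjectiveCofibrant.exists_lift {W : Weight A} (hW : W.IsProjectiveCofibrant)
    {E F : Weight A} (p : E ⟶ F)
    (hp : ∀ a n, HasLiftingProperty (SSet.boundary.{u} n).ι (p.app a)) (f : W ⟶ F) :
    ∃ g : W ⟶ E, g ≫ p = f := by
  obtain ⟨I, W', hI, j, hj, ⟨r⟩⟩ := hW
  have h : (projectiveCells (A := A)).rlp p := by
    rintro _ _ _ ⟨i, a⟩
    have h' : (MorphismProperty.monomorphisms SSet.{u}).rlp (p.app a) := by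
      rw [SSet.rlp_monomorphisms]
      rintro _ _ _ ⟨n⟩
      exact hp a n
    have := h' i (MorphismProperty.monomorphisms.infer_property i)
    exact hasLiftingProperty_tensorMap_representable i a p
  have := MorphismProperty.transfiniteCompositionsOfShape_pushouts_coproducts_le_llp_rlp.{u}
    _ _ _ hj p h
  have sq : CommSq (hI.to E) j p (r.r ≫ f) := ⟨hI.hom_ext _ _⟩
  exact ⟨r.i ≫ sq.lift, by rw [Category.assoc, sq.fac_right, Retract.retract_assoc]⟩

end Weight

/-! ### Full subweights -/

/-- The full simplicial subset spanned by a set of vertices: the simplices all of whose vertices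
belong to the set. -/
def fullSubcomplex {X : SSet.{u}} (V : Set (X _⦋0⦌)) : X.Subcomplex where
  obj n := Set.ofPred fun s => ∀ i : n ⟶ op ⦋0⦌, X.map i s ∈ V
  map f s hs i := by
    have : X.map i (X.map f s) = X.map (f ≫ i) s := by simp
    exact this ▸ hs (f ≫ i)

lemma mem_fullSubcomplex_vertex {X : SSet.{u}} (V : Set (X _⦋0⦌)) (x : X _⦋0⦌) :
    x ∈ (fullSubcomplex V).obj _ ↔ x ∈ V := by
  refine ⟨fun h => by simpa using h (𝟙 _), fun h i => ?_⟩
  obtain rfl : i = 𝟙 _ := Quiver.Hom.unop_inj (by ext; simp)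
  simpa using h

namespace Weight

/-- The restriction of the action of a weight to full simplicial subsets. -/
def fullAct (E : Weight A) (V : ∀ a, Set (E.obj a _⦋0⦌))
    (hV : ∀ a b, ∀ x ∈ V a, ∀ k : Map a b _⦋0⦌, (E.act a b).app _ (x, k) ∈ V b) (a b : A) :
    (fullSubcomplex (V a)).toSSet ⊗ Map a b ⟶ (fullSubcomplex (V b)).toSSet :=
  SSet.Subcomplex.lift ((fullSubcomplex (V a)).ι ▷ Map a b ≫ E.act a b) (by
    rintro n _ ⟨⟨x, k⟩, rfl⟩ i
    have h := hV a b _ (x.2 i) ((Map a b).map i k)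
    rw [act_map] at h
    exact h)

/-- The full subweight spanned by sets of vertices which are preserved by the vertices of the
simplicial sets `Map a b`. -/
def full (E : Weight A) (V : ∀ a, Set (E.obj a _⦋0⦌))
    (hV : ∀ a b, ∀ x ∈ V a, ∀ k : Map a b _⦋0⦌, (E.act a b).app _ (x, k) ∈ V b) : Weight A :=
  ofAction (fun a => (fullSubcomplex (V a)).toSSet)
    (fullAct E V hV)
    (fun a => by
      rw [← cancel_mono (fullSubcomplex (V a)).ι]
      ext n ⟨x, ⟨⟩⟩
      exact act_eId_apply E a x.1)
    (fun a b c => by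
      rw [← cancel_mono (fullSubcomplex (V c)).ι]
      ext n ⟨x, ⟨k, l⟩⟩
      exact act_eComp_apply E a b c x.1 k l)

variable {E : Weight A} {V : ∀ a, Set (E.obj a _⦋0⦌)}
  {hV : ∀ a b, ∀ x ∈ V a, ∀ k : Map a b _⦋0⦌, (E.act a b).app _ (x, k) ∈ V b}

lemma full_act (a b : A) : (full E V hV).act a b = fullAct E V hV a b :=
  ofAction_act _ _ _ _ a b

/-- The inclusion of a full subweight. -/
def fullι : full E V hV ⟶ E where
  app a := (fullSubcomplex (V a)).ι
  naturality a b := by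
    exact congrArg (· ≫ (fullSubcomplex (V b)).ι) (full_act a b)

/-- A map of weights whose vertices lie in the given sets factors through the full subweight. -/
def fullLift {W : Weight A} (f : W ⟶ E)
    (hf : ∀ a, ∀ w : W.obj a _⦋0⦌, (f.app a).app _ w ∈ V a) : W ⟶ full E V hV where
  app a := SSet.Subcomplex.lift (f.app a) (by
    rintro n _ ⟨x, rfl⟩ i
    have h := hf a ((W.obj a).map i x)
    rw [NatTrans.naturality_apply] at h
    exact h)
  naturality a b := by
    rw [full_act]
    ext n x
    exact Subtype.ext congr($(f.naturality a b).app n x)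

lemma fullι_app_mem {W : Weight A} (g : W ⟶ full E V hV) (a : A) (w : W.obj a _⦋0⦌) :
    ((g ≫ fullι).app a).app _ w ∈ V a :=
  (mem_fullSubcomplex_vertex _ _).1 ((g.app a).app _ w).2

/-- The terminal weight. -/
def terminal : Weight A :=
  ofAction (fun _ => 𝟙_ SSet.{u}) (fun _ _ => CartesianMonoidalCategory.toUnit _)
    (fun _ => CartesianMonoidalCategory.toUnit_unique _ _)
    (fun _ _ _ => CartesianMonoidalCategory.toUnit_unique _ _)

/-- The map to the terminal weight. -/
def toTerminal (E : Weight A) : E ⟶ terminal where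
  app _ := CartesianMonoidalCategory.toUnit _
  naturality _ _ := CartesianMonoidalCategory.toUnit_unique _ _

end Weight

/-! ### Weighted limits of simplicial sets and of quasi-categories -/

namespace Weight

/-- A map `L × W ⟶ E` exhibits `L` as the limit of `E` weighted by `W` in simplicial sets if
every map `Z × W ⟶ E` factors uniquely through it by a map `Z ⟶ L`. -/
def IsUniversal {L : SSet.{u}} {W E : Weight A} (l : tensor L W ⟶ E) : Prop :=
  ∀ (Z : SSet.{u}) (t : tensor Z W ⟶ E), ∃! h : Z ⟶ L, tensorMap h W ≫ l = t

/-- The limit of a simplicial functor `E` to simplicial sets weighted by `W`: the simplicial set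
whose `n`-simplices are the simplicial natural transformations `Δ[n] × W ⟶ E`. -/
def limitObj (W E : Weight A) : SSet.{u} where
  obj n := tensor (SSet.stdSimplex.obj n.unop) W ⟶ E
  map f := ↾fun φ => tensorMap (SSet.stdSimplex.map f.unop) W ≫ φ
  map_id n := by
    refine ConcreteCategory.hom_ext _ _ fun φ => ?_
    exact congrArg (fun g => tensorMap g W ≫ φ)
      (CategoryTheory.Functor.map_id SSet.stdSimplex n.unop)
  map_comp f g := rfl

/-- The universal map out of `limitObj W E × W`. -/
def limitπ (W E : Weight A) : tensor (limitObj W E) W ⟶ E where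
  app a :=
    { app := fun n => ↾fun x => (x.1.app a).app n (SSet.stdSimplex.objEquiv.symm (𝟙 _), x.2)
      naturality := fun n m f => by
        ext ⟨φ, w⟩
        exact congr($((φ.app a).naturality f) (SSet.stdSimplex.objEquiv.symm (𝟙 _), w)) }
  naturality a b := by
    ext n ⟨⟨φ, w⟩, k⟩
    have h := Hom.naturality_apply (Hom.mk φ.app φ.naturality) a b
      ((SSet.stdSimplex.objEquiv.symm (𝟙 _), w) :
        (SSet.stdSimplex.obj n.unop ⊗ W.obj a : SSet).obj n) k
    rw [tensor_act_apply] at h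
    let π : ((limitObj W E ⊗ W.obj b : SSet).obj n) → (E.obj b).obj n :=
      fun x => (x.1.app b).app n (SSet.stdSimplex.objEquiv.symm (𝟙 _), x.2)
    exact (congrArg π (tensor_act_apply (limitObj W E) W a b φ w k)).trans h

lemma limitπ_isUniversal (W E : Weight A) : IsUniversal (limitπ W E) := by
  intro Z t
  refine ⟨{ app := fun n => ↾fun z => tensorMap (SSet.yonedaEquiv.symm z) W ≫ t
            naturality := fun n m f => ?_ }, ?_, fun h hh => ?_⟩
  · refine ConcreteCategory.hom_ext _ _ fun z => Weight.hom_ext fun a => ?_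
    ext k ⟨x, w⟩
    exact congrArg (fun y => (t.app a).app k (y, w))
      congr(($(SSet.yonedaEquiv_symm_naturality_left f.unop z)).app k x).symm
  · refine Weight.hom_ext fun a => ?_
    ext n ⟨z, w⟩
    exact congrArg (fun y => (t.app a).app n (y, w)) (Z.map_id_apply n z)
  · subst hh
    ext n z
    refine Weight.hom_ext fun a => ?_
    ext m ⟨x, w⟩
    have e := congr($(h.naturality (SSet.stdSimplex.objEquiv x).op) z)
    have e' : ((h.app n z).app a).app m (x, w) = (((limitObj W E).map
        (SSet.stdSimplex.objEquiv x).op (h.app n z)).app a).app m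
          (SSet.stdSimplex.objEquiv.symm (𝟙 _), w) :=
      congrArg (fun y => ((h.app n z).app a).app m (y, w))
        (SSet.stdSimplex.objEquiv.injective (Category.id_comp _).symm)
    exact e'.trans (congrArg (fun y => (Hom.app y a).app m
      (SSet.stdSimplex.objEquiv.symm (𝟙 _), w)) e.symm)

/-- Reassociation of iterated tensors. -/
def tensorAssoc (X Y : SSet.{u}) (W : Weight A) : tensor (X ⊗ Y) W ⟶ tensor X (tensor Y W) where
  app a := (α_ X Y (W.obj a)).hom
  naturality a b := by
    ext n ⟨⟨⟨x, y⟩, w⟩, k⟩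
    exact (congrArg ((α_ X Y (W.obj b)).hom.app n)
      (tensor_act_apply (X ⊗ Y) W a b (x, y) w k)).trans
        ((tensor_act_apply X (tensor Y W) a b x (y, w) k).trans
          (congrArg (Prod.mk x) (tensor_act_apply Y W a b y w k))).symm

/-- The unit isomorphism of the tensor, as a map. -/
def tensorUnit (W : Weight A) : tensor (𝟙_ SSet.{u}) W ⟶ W where
  app a := (λ_ (W.obj a)).hom
  naturality a b := by
    ext n ⟨⟨x, w⟩, k⟩
    exact congrArg Prod.snd (tensor_act_apply (𝟙_ SSet.{u}) W a b x w k)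

end Weight

open Weight

/-- A diagram of quasi-categories, as a diagram of simplicial sets. The type `Weight` is that of all
simplicial functors to simplicial sets, and so it also serves for diagrams. -/
def diagramWeight (D : EnrichedFunctor SSet.{u} A SSet.QCat.{u}) : Weight A where
  functor :=
    { obj := fun a => (D.obj a).obj
      map := fun a b => D.map a b
      map_id := fun a => D.map_id a
      map_comp := fun a b c => D.map_comp a b c }

lemma cotensor_act_eq (D : EnrichedFunctor SSet.{u} A SSet.QCat.{u}) (W : Weight A)
    (L : SSet.QCat.{u}) (a b : A) (f : W.obj a ⟶ Map L (D.obj a)) :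
    (f ⊗ₘ D.map a b) ≫ eComp SSet.{u} L (D.obj a) (D.obj b) =
      f ▷ Map a b ≫ (cotensor L.obj (diagramWeight D)).act a b := by
  refine Eq.trans ?_ (congrArg (f ▷ Map a b ≫ ·)
    (ofAction_act (fun a => Map L.obj ((diagramWeight D).obj a)) _ _ _ a b).symm)
  rw [MonoidalCategory.tensorHom_def, Category.assoc]
  rfl

/-- Cones with vertex `L` over a diagram of quasi-categories, as maps `L × W ⟶ D`. -/
def coneEquiv {W : Weight A} {D : EnrichedFunctor SSet.{u} A SSet.QCat.{u}} {L : SSet.QCat.{u}} :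
    WeightedCone W D L ≃ (tensor L.obj W ⟶ diagramWeight D) :=
  Equiv.trans
    { toFun := fun c =>
        { app := c.app
          naturality := fun a b =>
            (c.naturality a b).trans (cotensor_act_eq D W L a b (c.app a)) }
      invFun := fun f =>
        { app := f.app
          naturality := fun a b =>
            (f.naturality a b).trans (cotensor_act_eq D W L a b (f.app a)).symm }
      left_inv := fun _ => rfl
      right_inv := fun _ => rfl }
    (tensorHomEquiv L.obj W (diagramWeight D)).symm

lemma coneEquiv_apply {W : Weight A} {D : EnrichedFunctor SSet.{u} A SSet.QCat.{u}}
    {L : SSet.QCat.{u}} (c : WeightedCone W D L) (a : A) {n} (x : L.obj.obj n)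
    (w : (W.obj a).obj n) :
    ((coneEquiv c).app a).app n (x, w) = ((c.app a).app n w).app n (𝟙 n) x := rfl

variable {W : Weight A} {D : EnrichedFunctor SSet.{u} A SSet.QCat.{u}} {L : SSet.QCat.{u}}

lemma quasicategory_tensorUnit : SSet.Quasicategory (𝟙_ SSet.{u}) :=
  ⟨fun _ _ _ _ _ => ⟨CartesianMonoidalCategory.toUnit _,
    CartesianMonoidalCategory.toUnit_unique _ _⟩⟩

/-- The equation in the universal property of a limit cone, in uncurried form. -/
lemma cone_comp_iff (c : WeightedCone W D L) (K : SSet.QCat.{u}) (X : SSet.{u})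
    (s : WeightedCone (tensor X W) D K) (g : X ⟶ Map K L) :
    (∀ a : A, (g ⊗ₘ c.app a) ≫ eComp SSet.{u} K L (D.obj a) = s.app a) ↔
      tensorMap (curryEquiv K.obj X L.obj g) W ≫ coneEquiv c =
        tensorAssoc K.obj X W ≫ coneEquiv s := by
  rw [Weight.hom_ext_iff]
  refine forall_congr' fun a => ?_
  refine (curryEquiv K.obj (X ⊗ W.obj a) (D.obj a).obj).injective.eq_iff.symm.trans
    ((cancel_epi (α_ K.obj X (W.obj a)).hom).symm.trans (Iff.of_eq (congrArg₂ Eq ?_ rfl)))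
  ext n x
  rfl

/-- A cone of quasi-categories is a limit cone if and only if it is one in simplicial sets: the
universal property with respect to the one-point quasi-category already amounts to the universal
property with respect to all simplicial sets. -/
lemma isLimit_iff_isUniversal (c : WeightedCone W D L) :
    c.IsLimit ↔ IsUniversal (coneEquiv c) := by
  refine ⟨fun hc Z t => ?_, fun hc K X s => ?_⟩
  · let K : SSet.QCat.{u} := ⟨𝟙_ SSet.{u}, quasicategory_tensorUnit⟩
    let s : WeightedCone (tensor Z W) D K := coneEquiv.symm (tensorUnit (tensor Z W) ≫ t)
    have key (g : Z ⟶ Map K L) := (cone_comp_iff c K Z s g).trans (Iff.of_eq (by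
      rw [Equiv.apply_symm_apply]))
    have key' (h : Z ⟶ L.obj) : tensorMap h W ≫ coneEquiv c = t ↔
        tensorMap ((λ_ Z).hom ≫ h) W ≫ coneEquiv c =
          tensorAssoc K.obj Z W ≫ tensorUnit (tensor Z W) ≫ t := by
      refine ⟨fun e => congrArg (tensorMap (λ_ Z).hom W ≫ ·) e, fun e => ?_⟩
      have e' := congrArg (tensorMap (λ_ Z).inv W ≫ ·) e
      exact e'
    obtain ⟨g, hg, hu⟩ := hc K Z s
    refine ⟨(λ_ Z).inv ≫ curryEquiv K.obj Z L.obj g, ?_, fun h hh => ?_⟩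
    · refine (key' _).2 ?_
      rw [Iso.hom_inv_id_assoc]
      exact (key g).1 hg
    · rw [Iso.eq_inv_comp]
      refine ((curryEquiv K.obj Z L.obj).symm_apply_eq).1 (hu _ ((key _).2 ?_))
      exact (congrArg (fun k => tensorMap k W ≫ coneEquiv c)
        ((curryEquiv K.obj Z L.obj).apply_symm_apply ((λ_ Z).hom ≫ h))).trans ((key' h).1 hh)
  · obtain ⟨h, hh, hu⟩ := hc _ (tensorAssoc K.obj X W ≫ coneEquiv s)
    refine ⟨(curryEquiv K.obj X L.obj).symm h, ?_, fun g hg => ?_⟩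
    · refine (cone_comp_iff c K X s _).2 ?_
      erw [Equiv.apply_symm_apply]
      exact hh
    · exact ((curryEquiv K.obj X L.obj).eq_symm_apply).2 (hu _ ((cone_comp_iff c K X s g).1 hg))

/-! ### Extensions into terminal vertices -/

/-- The last vertex of a simplex. -/
def lastVertex {X : SSet.{u}} {n : ℕ} (x : X _⦋n⦌) : X _⦋0⦌ :=
  X.map (SimplexCategory.const ⦋0⦌ ⦋n⦌ (Fin.last n)).op x

section Extension

variable {P Q B : SSet.{u}} (i : P ⟶ Q) (f : P ⟶ B)

/-- A map which is defined on the relative `d`-skeleton extends to the relative `d + 1`-skeleton: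
the boundary of each new simplex is a sphere which ends at a terminal vertex. -/
lemma exists_extension_skeleton_succ (hv : Function.Surjective (i.app (op ⦋0⦌)))
    (hf : ∀ (n : ℕ) (x : Q _⦋n + 1⦌), x ∉ Set.range (i.app _) →
      ∀ p : P _⦋0⦌, i.app _ p = lastVertex x → IsTerminalVertex B (f.app _ p))
    (d : ℕ) (g : (SSet.skeletonOfMono i d : SSet) ⟶ B)
    (hg : SSet.Subcomplex.lift i le_sup_left ≫ g = f) :
    ∃ g' : (SSet.skeletonOfMono i (d + 1) : SSet) ⟶ B,
      SSet.relativeCellComplexOfMono.r i d ≫ g' = g := by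
  have H : ∀ c : SSet.relativeCellComplexOfMono.Cell i d, ∃ y : Δ[d] ⟶ B,
      ∂Δ[d].ι ≫ y = c.ιSigmaBoundary ≫ SSet.relativeCellComplexOfMono.t i d ≫ g := by
    intro c
    obtain _ | d := d
    -- there are no new simplices of dimension zero
    · exact (c.notMem (hv _)).elim
    · obtain ⟨p, hp⟩ := hv (lastVertex c.simplex)
      refine (hf d c.simplex c.notMem p hp) d _ ?_
      have e : SSet.relativeCellComplexOfMono.Cell.ιSigmaBoundary c ≫
          SSet.relativeCellComplexOfMono.t i (d + 1) = SSet.Subcomplex.lift (∂Δ[d + 1].ι ≫ c.map)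
        (by simp [SSet.Subcomplex.range_comp, SSet.Subcomplex.image_le_iff]) := by simp
      rw [reassoc_of% e, ← hg]
      refine congrArg (g.app _) (Subtype.ext ?_)
      refine Eq.trans ?_ hp.symm
      rfl
  choose y hy using H
  exact ⟨(SSet.relativeCellComplexOfMono.isPushout i d).desc g (Limits.Sigma.desc y)
    (by ext c : 1; simp [hy]), by simp⟩

/-- A map to `B` extends along a monomorphism which is bijective on vertices, if the last vertex
of each new simplex is sent to a terminal vertex. -/
lemma exists_extension [Mono i] (hv : Function.Surjective (i.app (op ⦋0⦌)))
    (hf : ∀ (n : ℕ) (x : Q _⦋n + 1⦌), x ∉ Set.range (i.app _) →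
      ∀ p : P _⦋0⦌, i.app _ p = lastVertex x → IsTerminalVertex B (f.app _ p)) :
    ∃ g : Q ⟶ B, i ≫ g = f := by
  let T (d : ℕ) : Type u := { g : (SSet.skeletonOfMono i d : SSet) ⟶ B //
    SSet.Subcomplex.lift i le_sup_left ≫ g = f }
  have e₀ : SSet.skeletonOfMono i 0 ≤ SSet.Subcomplex.range i := by simp
  let g₀ : T 0 := ⟨SSet.Subcomplex.homOfLE e₀ ≫ inv (SSet.Subcomplex.toRange i) ≫ f, by
    exact IsIso.hom_inv_id_assoc (SSet.Subcomplex.toRange i) f⟩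
  have step (d : ℕ) (g : T d) : ∃ g' : T (d + 1),
      SSet.relativeCellComplexOfMono.r i d ≫ g'.1 = g.1 := by
    obtain ⟨g', hg'⟩ := exists_extension_skeleton_succ i f hv hf d g.1 g.2
    refine ⟨⟨g', ?_⟩, hg'⟩
    rw [← g.2, ← hg']
    rfl
  choose s hs using step
  let gs : ∀ d, T d := fun d => Nat.rec g₀ s d
  have hgs : ∀ d e (h : d ≤ e) (n) (x : Q.obj n) (hx : x ∈ (SSet.skeletonOfMono i d).obj n)
      (hx' : x ∈ (SSet.skeletonOfMono i e).obj n),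
      (gs d).1.app n ⟨x, hx⟩ = (gs e).1.app n ⟨x, hx'⟩ := by
    intro d e h
    induction e, h using Nat.le_induction with
    | base => intros; rfl
    | succ e h ih =>
      intro n x hx hx'
      have hx'' := (SSet.skeletonOfMono i).monotone h n hx
      rw [ih n x hx hx'']
      exact congr($(hs e (gs e)).app n ⟨x, hx''⟩).symm
  have mem (n : SimplexCategoryᵒᵖ) (x : Q.obj n) :
      x ∈ (SSet.skeletonOfMono i (n.unop.len + 1)).obj n := by
    have := SSet.skeletonOfMono_obj_eq_top i (Nat.lt_succ_self n.unop.len)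
    exact this.symm ▸ Set.mem_univ x
  refine ⟨{ app := fun n => ↾fun x => (gs (n.unop.len + 1)).1.app n ⟨x, mem n x⟩
            naturality := fun n m h => ?_ }, ?_⟩
  · ext x
    have e := congr($((gs (n.unop.len + 1)).1.naturality h) ⟨x, mem n x⟩)
    refine Eq.trans ?_ e
    obtain h' | h' := le_total (n.unop.len + 1) (m.unop.len + 1)
    · exact (hgs _ _ h' m _ ((SSet.skeletonOfMono i _).map h (mem n x)) _).symm
    · exact hgs _ _ h' m _ _ _
  · ext n x
    exact congr($((gs (n.unop.len + 1)).2).app n x)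

end Extension

section MapPre

variable {V Y B : SSet.{u}} (S : V.Subcomplex) (T : Y.Subcomplex)

/-- Lifting against the restriction `Map V B ⟶ Map S B` amounts to an extension
problem along the union of `V × T` and `S × Y`. -/
lemma exists_lift_mapPre (f : (T : SSet) ⟶ Map V B) (g : Y ⟶ Map (S : SSet) B)
    (w : T.ι ≫ g = f ≫ mapPre S.ι B)
    (H : ∀ h : (S.unionProd T : SSet) ⟶ B,
      SSet.Subcomplex.unionProd.ι₁ S T ≫ h = curryEquiv V T B f →
      SSet.Subcomplex.unionProd.ι₂ S T ≫ h = curryEquiv (S : SSet) Y B g →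
      ∃ e : V ⊗ Y ⟶ B, (S.unionProd T).ι ≫ e = h) :
    ∃ l : Y ⟶ Map V B, T.ι ≫ l = f ∧ l ≫ mapPre S.ι B = g := by
  have w' : S.ι ▷ (T : SSet) ≫ curryEquiv V T B f =
      (S : SSet) ◁ T.ι ≫ curryEquiv (S : SSet) Y B g :=
    (congrArg (curryEquiv (S : SSet) T B) w).symm
  obtain ⟨e, he⟩ := H ((SSet.Subcomplex.unionProd.isPushout S T).desc _ _ w')
    (by simp) (by simp)
  refine ⟨(curryEquiv V Y B).symm e, ?_, ?_⟩
  · apply (curryEquiv V T B).injective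
    rw [curryEquiv_comp, Equiv.apply_symm_apply, ← SSet.Subcomplex.unionProd.ι₁_ι S T,
      Category.assoc, he, IsPushout.inl_desc]
  · apply (curryEquiv (S : SSet) Y B).injective
    refine Eq.trans (b := S.ι ▷ Y ≫ e) ?_ ?_
    · exact congrArg (S.ι ▷ Y ≫ ·) ((curryEquiv V Y B).apply_symm_apply e)
    · rw [← SSet.Subcomplex.unionProd.ι₂_ι S T, Category.assoc, he, IsPushout.inr_desc]

/-- Restricting maps into a quasi-category along an inner horn inclusion is a trivial fibration. -/
lemma hasLiftingProperty_mapPre_horn [SSet.Quasicategory B] {n : ℕ} {k : Fin (n + 1)} (h0 : 0 < k)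
    (hn : k < Fin.last n) (m : ℕ) :
    HasLiftingProperty (SSet.boundary.{u} m).ι (mapPre (SSet.horn.{u} n k).ι B) where
  sq_hasLift {f g} sq := by
    obtain ⟨l, hl, hl'⟩ := exists_lift_mapPre _ _ f g sq.w.symm (fun h _ _ => by
      have := SSet.innerAnodyneExtensions_unionProd_ι' _ (SSet.boundary.{u} m)
        (SSet.innerAnodyneExtensions.horn_ι.{u} h0 hn)
      have := this (Limits.terminal.from B)
        (SSet.mem_innerFibrations (Limits.terminal.from B))
      have sq : CommSq h (Λ[n, k].unionProd ∂Δ[m]).ι (Limits.terminal.from B)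
        (Limits.terminal.from _) := ⟨Limits.terminal.hom_ext _ _⟩
      exact ⟨sq.lift, sq.fac_left⟩)
    exact ⟨⟨l, hl, hl'⟩⟩

end MapPre

section Terminal

/-- The full simplicial subset on the terminal vertices is a contractible Kan complex. -/
lemma exists_extension_fullSubcomplex_terminal {B : SSet.{u}} (hB : ∃ t, IsTerminalVertex B t)
    (n : ℕ) (x : (∂Δ[n] : SSet.{u}) ⟶ (fullSubcomplex (Set.ofPred (IsTerminalVertex B))).toSSet) :
    ∃ y : Δ[n] ⟶ (fullSubcomplex (Set.ofPred (IsTerminalVertex B))).toSSet,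
      ∂Δ[n].ι ≫ y = x := by
  obtain _ | n := n
  · obtain ⟨t, ht⟩ := hB
    exact ⟨SSet.const ⟨t, (mem_fullSubcomplex_vertex _ _).2 ht⟩, SSet.boundary.hom_ext₀⟩
  · obtain ⟨y, hy⟩ := (mem_fullSubcomplex_vertex _ _).1 (x.app _ (boundaryLast n)).2 n
      (x ≫ (fullSubcomplex _).ι) rfl
    refine ⟨SSet.Subcomplex.lift y ?_, ?_⟩
    · rintro m _ ⟨z, rfl⟩ i
      have hz : Δ[n + 1].map i z ∈ (SSet.boundary.{u} (n + 1)).obj (op ⦋0⦌) := by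
        rw [SSet.boundary_obj_eq_univ 0 (n + 1)]
        exact Set.mem_univ _
      have e : B.map i (y.app m z) = (x.app _ ⟨_, hz⟩).1 :=
        congr($(y.naturality i) z).symm.trans congr($(hy).app _ ⟨_, hz⟩)
      rw [e]
      exact (mem_fullSubcomplex_vertex _ _).1 (x.app _ ⟨_, hz⟩).2
    · rw [← cancel_mono (fullSubcomplex _).ι]
      exact hy

end Terminal

/-! ### Terminal vertices in weighted limits -/

namespace Weight

/-- A simplicial functor to simplicial sets preserves terminal objects if the functors by which
it acts do. -/
def PreservesTerminal (E : Weight A) : Prop :=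
  ∀ a b, ∀ x : E.obj a _⦋0⦌, IsTerminalVertex (E.obj a) x → ∀ k : Map a b _⦋0⦌,
    IsTerminalVertex (E.obj b) ((E.act a b).app _ (x, k))

/-- The vertices `U ⟶ E a` of the cotensor which send the vertex `x` of `U` to a terminal
vertex. -/
def evalTerminal {U : SSet.{u}} (x : U _⦋0⦌) (E : Weight A) (a : A) :
    Set ((cotensor U E).obj a _⦋0⦌) :=
  Set.ofPred fun φ => IsTerminalVertex (E.obj a) (φ.app _ (𝟙 _) x)

lemma PreservesTerminal.evalTerminal {E : Weight A} (hE : E.PreservesTerminal) {U : SSet.{u}}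
    (x : U _⦋0⦌) (a b : A) (φ : (cotensor U E).obj a _⦋0⦌) (hφ : φ ∈ evalTerminal x E a)
    (k : Map a b _⦋0⦌) : ((cotensor U E).act a b).app _ (φ, k) ∈ Weight.evalTerminal x E b := by
  have h := cotensor_act_apply U E a b φ k (𝟙 _) x
  rw [Functor.map_id_apply] at h
  exact (congrArg (IsTerminalVertex (E.obj b)) h).mpr (hE a b _ hφ k)

/-- The cotensor with `U`, restricted to the maps which send `x` to a terminal vertex. -/
abbrev cotensorTerminal {U : SSet.{u}} (x : U _⦋0⦌) {E : Weight A} (hE : E.PreservesTerminal) :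
    Weight A :=
  full (cotensor U E) (evalTerminal x E) (hE.evalTerminal x)

/-- The last vertex of `Δ[n + 1]`. -/
abbrev stdSimplexLast (n : ℕ) : (Δ[n + 1] : SSet.{u}) _⦋0⦌ :=
  SSet.stdSimplex.obj₀Equiv.symm (Fin.last (n + 1))

/-- Restriction to the boundary, for maps which send the last vertex to a terminal vertex. -/
def cotensorTerminalMap {E : Weight A} (hE : E.PreservesTerminal) (n : ℕ) :
    cotensorTerminal (stdSimplexLast n) hE ⟶ cotensorTerminal (boundaryLast n) hE :=
  fullLift (fullι ≫ cotensorMap ∂Δ[n + 1].ι E) (fun a w =>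
    fullι_app_mem (𝟙 (cotensorTerminal (stdSimplexLast n) hE)) a w)

end Weight

/-- A simplex of `Δ[n + 1] × Δ[m]` outside the pushout product of the boundaries projects onto
`Δ[n + 1]`, and so it ends over the last vertex of `Δ[n + 1]`. -/
lemma fst_lastVertex_of_notMem {n m d : ℕ} (x : (Δ[n + 1] ⊗ Δ[m] : SSet.{u}) _⦋d⦌)
    (hx : x ∉ ((SSet.boundary.{u} (n + 1)).unionProd (SSet.boundary.{u} m)).obj _) :
    (lastVertex x).1 = Weight.stdSimplexLast n := by
  have hx' : x.1 ∉ (SSet.boundary.{u} (n + 1)).obj _ := fun h => hx (Or.inr ⟨h, trivial⟩)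
  rw [SSet.mem_boundary_iff_notMem_range] at hx'
  push Not at hx'
  obtain ⟨j, hj⟩ := hx' (Fin.last _)
  apply SSet.stdSimplex.obj₀Equiv.injective
  rw [Equiv.apply_symm_apply]
  refine le_antisymm (Fin.le_last _) ?_
  rw [← hj]
  exact SSet.stdSimplex.monotone_apply x.1 (Fin.le_last j)

namespace Weight

/-- Restriction to the boundary is an objectwise trivial fibration, on the maps which send the last
vertex to a terminal vertex: the lifting problems amount to extensions along the inclusion of
`Δ[n + 1] × ∂Δ[m] ∪ ∂Δ[n + 1] × Δ[m]` in `Δ[n + 1] × Δ[m]`. -/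
lemma hasLiftingProperty_cotensorTerminalMap {E : Weight A} (hE : E.PreservesTerminal) (n : ℕ)
    (a : A) (m : ℕ) :
    HasLiftingProperty (SSet.boundary.{u} m).ι ((cotensorTerminalMap hE n).app a) where
  sq_hasLift {f g} sq := by
    let f' : (∂Δ[m] : SSet.{u}) ⟶ Map Δ[n + 1] (E.obj a) := f ≫ (fullSubcomplex _).ι
    let g' : Δ[m] ⟶ Map (∂Δ[n + 1] : SSet.{u}) (E.obj a) := g ≫ (fullSubcomplex _).ι
    have w : ∂Δ[m].ι ≫ g' = f' ≫ mapPre ∂Δ[n + 1].ι (E.obj a) :=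
      (congrArg (· ≫ (fullSubcomplex _).ι) sq.w).symm
    have hg' (z : Δ[m] _⦋0⦌) : g'.app _ z ∈ evalTerminal (boundaryLast n) E a :=
      (mem_fullSubcomplex_vertex _ _).1 (g.app _ z).2
    obtain ⟨l, hl, hl'⟩ := exists_lift_mapPre _ _ f' g' w (fun h _ h₂ => by
      refine exists_extension _ h (fun v => ⟨⟨v, Or.inr ⟨?_, trivial⟩⟩, rfl⟩) fun d x hx p hp => ?_
      · rw [SSet.boundary_obj_eq_univ 0 (n + 1)]
        exact Set.mem_univ _
      · have hx' : x ∉ ((SSet.boundary.{u} (n + 1)).unionProd (SSet.boundary.{u} m)).obj _ :=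
          fun h => hx ⟨⟨x, h⟩, rfl⟩
        have e : p = (SSet.Subcomplex.unionProd.ι₂ (SSet.boundary.{u} (n + 1))
            (SSet.boundary.{u} m)).app _ (boundaryLast n, (lastVertex x).2) :=
          Subtype.ext (hp.trans (Prod.ext (fst_lastVertex_of_notMem x hx') rfl))
        rw [e]
        have h₂' := congr($(h₂).app _ (boundaryLast n, (lastVertex x).2))
        exact h₂'.symm ▸ hg' _)
    refine ⟨⟨SSet.Subcomplex.lift l ?_, ?_, ?_⟩⟩
    · rintro k _ ⟨z, rfl⟩ i
      have e : (Map Δ[n + 1] (E.obj a)).map i (l.app k z) = l.app _ (Δ[m].map i z) :=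
        congr($(l.naturality i) z).symm
      have h := hg' (Δ[m].map i z)
      rw [← hl'] at h
      exact e.symm ▸ h
    · exact (cancel_mono (fullSubcomplex (evalTerminal (stdSimplexLast n) E a)).ι).1 hl
    · exact (cancel_mono (fullSubcomplex (evalTerminal (boundaryLast n) E a)).ι).1 hl'

variable {W E : Weight A} {L : SSet.{u}} {l : tensor L W ⟶ E}

/-- In a weighted limit, the vertices with terminal components are terminal: a sphere `x` in the
limit is a map from `W` to the cotensor with `∂Δ[n + 1]`, and a lift of it to the cotensor with
`Δ[n + 1]` is a filler. -/
lemma IsUniversal.isTerminalVertex (hW : W.IsProjectiveCofibrant) (hE : E.PreservesTerminal)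
    (hl : IsUniversal l) (t : L _⦋0⦌)
    (ht : ∀ a, ∀ w : W.obj a _⦋0⦌, IsTerminalVertex (E.obj a) ((l.app a).app _ (t, w))) :
    IsTerminalVertex L t := by
  intro n x hx
  obtain ⟨g, hg⟩ := hW.exists_lift (cotensorTerminalMap hE n)
    (hasLiftingProperty_cotensorTerminalMap hE n)
    (fullLift (tensorHomEquiv _ _ _ (tensorMap x W ≫ l)) (fun a w => by
      have e : (((tensorHomEquiv _ _ _ (tensorMap x W ≫ l)).app a).app _ w).app _ (𝟙 _)
          (boundaryLast n) = (l.app a).app _ (x.app _ (boundaryLast n),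
            (W.obj a).map (𝟙 _) w) := rfl
      rw [Functor.map_id_apply, hx] at e
      exact (congrArg (IsTerminalVertex (E.obj a)) e).mpr (ht a w)))
  obtain ⟨y, hy, -⟩ := hl _ ((tensorHomEquiv _ _ _).symm (g ≫ fullι))
  refine ⟨y, (hl _ (tensorMap x W ≫ l)).unique ?_ rfl⟩
  apply (tensorHomEquiv _ _ _).injective
  have h := congrArg (· ≫ fullι) hg
  refine Eq.trans ?_ h
  have hy' := congrArg (tensorHomEquiv _ _ _) hy
  rw [Equiv.apply_symm_apply] at hy'
  exact congrArg (· ≫ cotensorMap ∂Δ[n + 1].ι E) hy'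

/-- A weighted limit of simplicial sets with terminal vertices has a vertex with terminal
components, since the terminal vertices span a diagram of contractible Kan complexes. -/
lemma IsUniversal.exists_vertex (hW : W.IsProjectiveCofibrant) (hE : E.PreservesTerminal)
    (hE' : ∀ a, ∃ t, IsTerminalVertex (E.obj a) t) (hl : IsUniversal l) :
    ∃ t : L _⦋0⦌, ∀ a, ∀ w : W.obj a _⦋0⦌,
      IsTerminalVertex (E.obj a) ((l.app a).app _ (t, w)) := by
  let T : Weight A := full E (fun a => Set.ofPred (IsTerminalVertex (E.obj a))) hE
  obtain ⟨g, -⟩ := hW.exists_lift (toTerminal T) (fun a n => ⟨fun {f g} sq => by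
    obtain ⟨y, hy⟩ := exists_extension_fullSubcomplex_terminal (hE' a) n f
    exact ⟨⟨y, hy, CartesianMonoidalCategory.toUnit_unique _ _⟩⟩⟩) (toTerminal W)
  obtain ⟨h, hh, -⟩ := hl _ (tensorUnit W ≫ g ≫ fullι)
  refine ⟨h.app _ PUnit.unit, fun a w => ?_⟩
  have e : (l.app a).app _ (h.app _ PUnit.unit, w) = ((g ≫ fullι).app a).app _ w :=
    congr(($(hh).app a).app _ (PUnit.unit, w))
  exact e.symm ▸ fullι_app_mem g a w

/-- A weighted limit of quasi-categories is a quasi-category, since restriction from simplices to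
inner horns is an objectwise trivial fibration. -/
lemma IsUniversal.quasicategory (hW : W.IsProjectiveCofibrant)
    (hE : ∀ a, SSet.Quasicategory (E.obj a)) (hl : IsUniversal l) : SSet.Quasicategory L where
  hornFilling' {n i} x h0 hn := by
    obtain ⟨g, hg⟩ := hW.exists_lift (cotensorMap (SSet.horn.{u} (n + 2) i).ι E)
      (fun a m => hasLiftingProperty_mapPre_horn h0 hn m)
      (tensorHomEquiv _ _ _ (tensorMap x W ≫ l))
    obtain ⟨y, hy, -⟩ := hl _ ((tensorHomEquiv _ _ _).symm g)
    refine ⟨y, (hl _ (tensorMap x W ≫ l)).unique rfl ?_⟩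
    apply (tensorHomEquiv _ _ _).injective
    refine Eq.trans ?_ hg
    have hy' := congrArg (tensorHomEquiv _ _ _) hy
    rw [Equiv.apply_symm_apply] at hy'
    exact congrArg (· ≫ cotensorMap Λ[n + 2, i].ι E) hy'

end Weight

/-! ### Inner horn extensions between subcomplexes of a simplex -/

section Attach

variable {X B : SSet.{u}}

/-- A map from a subcomplex `Q` to a quasi-category extends to a nondegenerate simplex `m` which
meets `Q` in an inner horn. -/
lemma exists_extension_sup_range [SSet.Quasicategory B] (Q : X.Subcomplex) {d : ℕ}
    (m : Δ[d] ⟶ X) [Mono m] {k : Fin (d + 1)} (h0 : 0 < k) (hd : k < Fin.last d)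
    (hm : ∀ (e : SimplexCategoryᵒᵖ) (z : (Δ[d] : SSet.{u}).obj e),
      m.app _ z ∈ Q.obj _ ↔ z ∈ (SSet.horn.{u} d k).obj _) (f : (Q : SSet) ⟶ B) :
    ∃ g : ((Q ⊔ SSet.Subcomplex.range m : X.Subcomplex) : SSet) ⟶ B,
      SSet.Subcomplex.homOfLE le_sup_left ≫ g = f := by
  let h : (Λ[d, k] : SSet.{u}) ⟶ B := SSet.Subcomplex.lift (Λ[d, k].ι ≫ m) (by
    rintro e _ ⟨z, rfl⟩
    exact (hm _ z.1).2 z.2) ≫ f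
  obtain ⟨y, hy⟩ := SSet.Quasicategory.hornFilling h0 hd h
  have sq : SSet.Subcomplex.BicartSq (Q ⊓ SSet.Subcomplex.range m) Q (SSet.Subcomplex.range m)
    (Q ⊔ SSet.Subcomplex.range m) := ⟨rfl, rfl⟩
  refine ⟨sq.isPushout.desc f (inv (SSet.Subcomplex.toRange m) ≫ y) ?_, sq.isPushout.inl_desc ..⟩
  ext e ⟨z, hz, z', rfl⟩
  have e₁ : (inv (SSet.Subcomplex.toRange m)).app e ⟨m.app _ z', z', rfl⟩ = z' :=
    congr($(IsIso.hom_inv_id (SSet.Subcomplex.toRange m)).app e z')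
  have e₂ := congr($(hy).app e ⟨z', (hm _ _).1 hz⟩)
  exact e₂.trans (congrArg (y.app e) e₁.symm)

end Attach

section Faces

variable {N : ℕ}

/-- The set of vertices of a simplex of `Δ[N]`. -/
def support {e : SimplexCategoryᵒᵖ} (z : (Δ[N] : SSet.{u}).obj e) : Finset (Fin (N + 1)) :=
  Finset.univ.image (SSet.stdSimplex.asOrderHom z)

lemma mem_support {e : SimplexCategoryᵒᵖ} (z : (Δ[N] : SSet.{u}).obj e) (i : Fin (N + 1)) :
    i ∈ support z ↔ ∃ j, SSet.stdSimplex.asOrderHom z j = i := by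
  simp [support]

lemma support_map_subset {e e' : SimplexCategoryᵒᵖ} (α : e ⟶ e')
    (z : (Δ[N] : SSet.{u}).obj e) : support (Δ[N].map α z) ⊆ support z := by
  intro i hi
  rw [mem_support] at hi ⊢
  obtain ⟨j, rfl⟩ := hi
  exact ⟨α.unop.toOrderHom j, rfl⟩

/-- The subcomplex of `Δ[N]` whose nondegenerate simplices are the nonempty members of a given
downward closed family of sets of vertices. -/
def ofFaces (F : LowerSet (Finset (Fin (N + 1)))) : (Δ[N] : SSet.{u}).Subcomplex where
  obj _ := Set.ofPred fun z => support z ∈ F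
  map α z hz := F.lower (support_map_subset α z) hz

lemma mem_ofFaces (F : LowerSet (Finset (Fin (N + 1)))) {e : SimplexCategoryᵒᵖ}
    (z : (Δ[N] : SSet.{u}).obj e) : z ∈ (ofFaces F).obj e ↔ support z ∈ F := Iff.rfl

lemma ofFaces_mono {F G : LowerSet (Finset (Fin (N + 1)))} (h : F ≤ G) :
    ofFaces.{u} F ≤ ofFaces G := fun _ _ hz => h hz

lemma support_map_app {M : ℕ} (f : Fin (M + 1) →o Fin (N + 1)) {e : SimplexCategoryᵒᵖ}
    (z : (Δ[M] : SSet.{u}).obj e) :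
    support ((SSet.stdSimplex.{u}.map (SimplexCategory.mkHom f)).app e z) =
      (support z).image f := by
  ext i
  simp only [mem_support, Finset.mem_image]
  constructor
  · rintro ⟨j, rfl⟩
    exact ⟨_, ⟨j, rfl⟩, rfl⟩
  · rintro ⟨_, ⟨j, rfl⟩, rfl⟩
    exact ⟨j, rfl⟩

/-- Attaching the face `insert p S` and its face `S` opposite to `p` amounts to filling an inner
horn, if `p` lies between two elements of `S`. -/
lemma exists_extension_insert {B : SSet.{u}} [SSet.Quasicategory B]
    (F G : LowerSet (Finset (Fin (N + 1)))) (hFG : F ≤ G) (S : Finset (Fin (N + 1)))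
    (p : Fin (N + 1)) (hp : p ∉ S) (h₁ : ∃ i ∈ S, i < p) (h₂ : ∃ i ∈ S, p < i)
    (hS : S ∉ F) (hSF : ∀ j ∈ S, (insert p S).erase j ∈ F)
    (hG : ∀ T, T ∈ G → T ∈ F ∨ T ⊆ insert p S) (f : (ofFaces.{u} F : SSet) ⟶ B) :
    ∃ g : (ofFaces.{u} G : SSet) ⟶ B, SSet.Subcomplex.homOfLE (ofFaces_mono hFG) ≫ g = f := by
  obtain ⟨d, hd⟩ : ∃ d, (insert p S).card = d + 1 :=
    Nat.exists_eq_succ_of_ne_zero (by simp)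
  -- the increasing enumeration of `insert p S`, and the simplex `m` with these vertices
  let e : Fin (d + 1) ↪o Fin (N + 1) := (insert p S).orderEmbOfFin hd
  have he (i : Fin (d + 1)) : e i ∈ insert p S := Finset.orderEmbOfFin_mem _ hd i
  have he' (i : Fin (N + 1)) (hi : i ∈ insert p S) : ∃ j, e j = i := by
    have : i ∈ Set.range e := by
      rw [Finset.range_orderEmbOfFin]
      exact hi
    exact this
  obtain ⟨k, hk⟩ := he' p (by simp)
  let m : (Δ[d] : SSet.{u}) ⟶ Δ[N] :=
    SSet.stdSimplex.{u}.map (SimplexCategory.mkHom (OrderHomClass.toOrderHom e))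
  have : Mono m := by
    have : Mono (SimplexCategory.mkHom (n := d) (m := N) (OrderHomClass.toOrderHom e)) :=
      SimplexCategory.mono_iff_injective.2 e.injective
    exact inferInstanceAs (Mono (uliftYoneda.{u}.map _))
  have hm (l : SimplexCategoryᵒᵖ) (z : (Δ[d] : SSet.{u}).obj l) :
      m.app _ z ∈ (ofFaces F).obj _ ↔ z ∈ (SSet.horn.{u} d k).obj _ := by
    have hz : support (m.app _ z) = (support z).image e := support_map_app _ z
    rw [mem_ofFaces, hz, SSet.mem_horn_iff, Ne, Set.eq_univ_iff_forall, not_forall]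
    constructor
    · intro h
      by_contra! h'
      refine hS (F.lower (fun i hi => ?_) h)
      obtain ⟨j, rfl⟩ := he' i (Finset.mem_insert_of_mem hi)
      have hj : j ≠ k := by
        rintro rfl
        exact hp (hk ▸ hi)
      refine Finset.mem_image_of_mem _ ((mem_support _ _).2 ((h' j).resolve_right hj))
    · rintro ⟨j, hj⟩
      have hj' : e j ≠ p := fun h => hj (Or.inr (e.injective (h.trans hk.symm)))
      refine F.lower ?_ (hSF (e j) ((Finset.mem_insert.1 (he j)).resolve_left hj'))
      intro i hi
      obtain ⟨i', hi', rfl⟩ := Finset.mem_image.1 hi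
      refine Finset.mem_erase.2 ⟨fun h => hj (Or.inl ?_), he i'⟩
      exact (mem_support _ _).1 (e.injective h ▸ hi')
  have h0 : 0 < k := by
    obtain ⟨i, hi, hip⟩ := h₁
    obtain ⟨j, rfl⟩ := he' i (Finset.mem_insert_of_mem hi)
    rw [← hk, e.lt_iff_lt] at hip
    exact (Fin.zero_le j).trans_lt hip
  have hl : k < Fin.last d := by
    obtain ⟨i, hi, hip⟩ := h₂
    obtain ⟨j, rfl⟩ := he' i (Finset.mem_insert_of_mem hi)
    rw [← hk, e.lt_iff_lt] at hip
    exact hip.trans_le (Fin.le_last j)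
  have hle : ofFaces.{u} G ≤ ofFaces F ⊔ SSet.Subcomplex.range m := by
    intro l z hz
    refine (hG _ hz).imp id fun h => ?_
    have hz' (i) : ∃ j, e j = SSet.stdSimplex.asOrderHom z i :=
      he' _ (h ((mem_support _ _).2 ⟨i, rfl⟩))
    choose t ht using hz'
    refine ⟨SSet.stdSimplex.objMk ⟨t, fun i j hij => ?_⟩, ?_⟩
    · rw [← e.le_iff_le, ht, ht]
      exact (SSet.stdSimplex.asOrderHom z).monotone hij
    · exact SSet.stdSimplex.ext _ _ ht
  obtain ⟨g, hg⟩ := exists_extension_sup_range (ofFaces F) m h0 hl hm f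
  exact ⟨SSet.Subcomplex.homOfLE hle ≫ g, hg⟩

/-- Let `F ≤ G` be families of faces of `Δ[N]` such that the members of `G` outside `F` come in
pairs `S`, `insert p S` with `p` an inner vertex. Then the inclusion is a composite of
attachments along inner horns, so that maps to quasi-categories extend. -/
lemma exists_extension_ofFaces {B : SSet.{u}} [SSet.Quasicategory B] (p : Fin (N + 1))
    (F G : LowerSet (Finset (Fin (N + 1)))) (hFG : F ≤ G)
    (h : ∀ S ∈ G, S ∉ F → insert p S ∈ G ∧ S.erase p ∉ F ∧ (∃ i ∈ S, i < p) ∧ ∃ i ∈ S, p < i)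
    (f : (ofFaces.{u} F : SSet) ⟶ B) :
    ∃ g : (ofFaces.{u} G : SSet) ⟶ B, SSet.Subcomplex.homOfLE (ofFaces_mono hFG) ≫ g = f := by
  induction F using WellFoundedGT.induction with
  | ind F ih =>
  by_cases hF : G ≤ F
  · obtain rfl := le_antisymm hFG hF
    exact ⟨f, rfl⟩
  obtain ⟨S₀, hS₀, hS₀'⟩ := Set.not_subset.1 hF
  -- a minimal missing face `S` does not contain `p`, and all the faces of `insert p S` except `S`
  -- are already present
  obtain ⟨S, -, hS⟩ := (Set.toFinite {S | S ∈ G ∧ S ∉ F}).exists_le_minimal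
    (show S₀ ∈ {S | S ∈ G ∧ S ∉ F} from ⟨hS₀, hS₀'⟩)
  obtain ⟨hSG, hSF⟩ := hS.prop
  have hmin (T : Finset (Fin (N + 1))) (hT : T ∈ G) (hT' : T ∉ F) (hTS : T ⊆ S) : T = S :=
    subset_antisymm hTS (hS.le_of_le ⟨hT, hT'⟩ hTS)
  obtain ⟨hpS, hSp, h₁, h₂⟩ := h S hSG hSF
  have hp : p ∉ S := fun hp => Finset.erase_eq_self.1
    (hmin _ (G.lower (Finset.erase_subset _ _) hSG) hSp (Finset.erase_subset _ _)) hp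
  have hSe (j : Fin (N + 1)) (hj : j ∈ S) : (insert p S).erase j ∈ F := by
    by_contra hj'
    have hjG := G.lower (Finset.erase_subset j _) hpS
    have hpj : p ≠ j := fun e => hp (e ▸ hj)
    have e : ((insert p S).erase j).erase p = S.erase j := by
      rw [Finset.erase_right_comm, Finset.erase_insert hp]
    have := (h _ hjG hj').2.1
    rw [e] at this
    exact Finset.erase_eq_self.1 (hmin _ (G.lower (Finset.erase_subset _ _) hSG) this
      (Finset.erase_subset _ _)) hj
  let F' : LowerSet (Finset (Fin (N + 1))) := F ⊔ LowerSet.Iic (insert p S)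
  have hF'G : F' ≤ G := sup_le hFG (LowerSet.Iic_le.2 hpS)
  have hF' (T : Finset (Fin (N + 1))) : T ∈ F' ↔ T ∈ F ∨ T ⊆ insert p S := Iff.rfl
  obtain ⟨g, hg⟩ := exists_extension_insert F F' le_sup_left S p hp h₁ h₂ hSF hSe
    (fun T hT => hT) f
  obtain ⟨g', hg'⟩ := ih F' (lt_of_le_of_ne le_sup_left fun e => hSF (e ▸ (hF' S).2
    (Or.inr (Finset.subset_insert _ _)))) hF'G (fun T hT hT' => by
      rw [hF', not_or] at hT'
      obtain ⟨a, b, c⟩ := h T hT hT'.1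
      refine ⟨a, ?_, c⟩
      rw [hF', not_or]
      exact ⟨b, fun h' => hT'.2 (by simpa using Finset.subset_insert_iff.2 h')⟩) g
  exact ⟨g', by rw [← hg, ← hg']; rfl⟩

end Faces

/-! ### Retracts of terminal vertices -/

section Retract

variable (n : ℕ)

/-- The retraction of `[n + 3]` onto `[n + 1]` which sends `n + 1`, `n + 2` and `n + 3` to
`n + 1`. -/
def collapseTail : Fin (n + 4) →o Fin (n + 2) where
  toFun i := ⟨min i (n + 1), by omega⟩
  monotone' i j h := by
    simp only [Fin.mk_le_mk]
    exact min_le_min_right _ h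

/-- The map from `[n + 3]` to `[2]` which sends `n + 1`, `n + 2` and `n + 3` to
`0`, `1` and `2`. -/
def tailMap : Fin (n + 4) →o Fin 3 where
  toFun i := ⟨i - (n + 1), by omega⟩
  monotone' i j h := by
    simp only [Fin.mk_le_mk]
    exact Nat.sub_le_sub_right h _

/-- The faces which do not contain the vertex `n + 2` and become faces of the boundary when
the vertices `n + 1` and `n + 3` are identified. -/
def boundaryFaces : LowerSet (Finset (Fin (n + 4))) where
  carrier := {S | (∀ i ∈ S, i.1 ≠ n + 2) ∧ ∃ j : Fin (n + 2), ∀ i ∈ S, collapseTail n i ≠ j}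
  lower' _ _ h hS := ⟨fun i hi => hS.1 i (h hi), hS.2.imp fun _ hj i hi => hj i (h hi)⟩

/-- The faces of the triangle on the last three vertices. -/
def tailFaces : LowerSet (Finset (Fin (n + 4))) where
  carrier := {S | ∀ i ∈ S, n + 1 ≤ i.1}
  lower' _ _ h hS i hi := hS i (h hi)

/-- The faces which do not contain all the vertices `0`, ..., `k`. -/
def missingFaces (k : ℕ) : LowerSet (Finset (Fin (n + 4))) where
  carrier := {S | ∃ j : Fin (n + 4), j.1 ≤ k ∧ j ∉ S}
  lower' _ _ h hS := hS.imp fun _ hj => ⟨hj.1, fun h' => hj.2 (h h')⟩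

/-- The faces which do not contain any vertex from `V`. -/
def avoidingFaces (V : Set ℕ) : LowerSet (Finset (Fin (n + 4))) where
  carrier := {S | ∀ i ∈ S, i.1 ∉ V}
  lower' _ _ h hS i hi := hS i (h hi)

variable {n}

lemma mem_boundaryFaces (S : Finset (Fin (n + 4))) : S ∈ boundaryFaces n ↔
    (∀ i ∈ S, i.1 ≠ n + 2) ∧ ∃ j ≤ n + 1, ∀ i ∈ S, min i.1 (n + 1) ≠ j := by
  refine and_congr_right fun _ => ⟨?_, ?_⟩
  · rintro ⟨j, hj⟩
    exact ⟨j, by omega, fun i hi h => hj i hi (Fin.ext h)⟩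
  · rintro ⟨j, hj, hj'⟩
    exact ⟨⟨j, by omega⟩, fun i hi h => hj' i hi congr(($h).1)⟩

lemma mem_tailFaces (S : Finset (Fin (n + 4))) : S ∈ tailFaces n ↔ ∀ i ∈ S, n + 1 ≤ i.1 :=
  Iff.rfl

lemma mem_missingFaces (k : ℕ) (S : Finset (Fin (n + 4))) :
    S ∈ missingFaces n k ↔ ∃ j : Fin (n + 4), j.1 ≤ k ∧ j ∉ S := Iff.rfl

lemma mem_avoidingFaces (V : Set ℕ) (S : Finset (Fin (n + 4))) :
    S ∈ avoidingFaces n V ↔ ∀ i ∈ S, i.1 ∉ V := Iff.rfl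

lemma boundaryFaces_le : boundaryFaces n ≤ missingFaces n n ⊔ avoidingFaces n {n + 1, n + 3} := by
  intro S hS
  obtain ⟨h, j, hj, hj'⟩ := (mem_boundaryFaces S).1 hS
  obtain rfl | hj := hj.eq_or_lt
  · refine Or.inr fun i hi => ?_
    have := hj' i hi
    simp
    omega
  · exact Or.inl ⟨⟨j, by omega⟩, by simp; omega, fun h => hj' _ h (by simp; omega)⟩

lemma tailFaces_le (k : ℕ) : tailFaces n ≤ missingFaces n k := fun S hS =>
  ⟨0, by simp, fun h => by simpa using hS 0 h⟩

/-- A face which misses `n + 3` and one of the vertices `0`, ..., `n + 1` is a member of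
`boundaryFaces n`, or contains `n + 2`, which is then its last vertex. -/
lemma missingFaces_inf_le (S : Finset (Fin (n + 4))) (hS : S ∈ missingFaces n (n + 1))
    (hS' : S ∈ avoidingFaces n {n + 3}) :
    S ∈ boundaryFaces n ∨ ⟨n + 2, by omega⟩ ∈ S := by
  obtain ⟨j, hj, hj'⟩ := hS
  refine or_iff_not_imp_right.2 fun h => (mem_boundaryFaces S).2 ⟨?_, j, hj, ?_⟩
  · rintro ⟨i, _⟩ hi rfl
    exact h hi
  · intro i hi hij
    have h₃ := hS' i hi
    have h₂ : i.1 ≠ n + 2 := fun e => h (by convert hi; exact e.symm)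
    simp at h₃
    refine hj' ?_
    convert hi
    omega

variable (n) in
/-- The faces on which the map to be constructed is given, together with those whose last vertex
is `n + 2` and which miss one of the vertices `0`, ..., `n + 1`. -/
def coneFaces : LowerSet (Finset (Fin (n + 4))) :=
  (boundaryFaces n ⊔ tailFaces n) ⊔ (missingFaces n (n + 1) ⊓ avoidingFaces n {n + 3})

lemma coneFaces_le : coneFaces n ≤ missingFaces n n ⊔ avoidingFaces n {n + 1, n + 3} := by
  refine sup_le (sup_le boundaryFaces_le ((tailFaces_le n).trans le_sup_left)) ?_
  rintro S ⟨⟨j, hj, hj'⟩, h⟩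
  obtain hj | hj := hj.eq_or_lt
  · refine Or.inr fun i hi => ?_
    have h₁ := h i hi
    have h₂ : i.1 ≠ n + 1 := fun e => hj' (by convert hi; omega)
    simp at h₁ ⊢
    omega
  · exact Or.inl ⟨j, by omega, hj'⟩

lemma sup_avoidingFaces_le :
    missingFaces n n ⊔ avoidingFaces n {n + 1, n + 3} ≤ missingFaces n (n + 1) := by
  refine sup_le ?_ ?_
  · rintro S ⟨j, hj, hj'⟩
    exact ⟨j, by omega, hj'⟩
  · exact fun S hS => ⟨⟨n + 1, by omega⟩, by simp, fun h => hS _ h (by simp)⟩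

/-- The faces outside `coneFaces n` which do not contain all of `0`, ..., `n + 1` can be attached
along inner horns, first by means of the inner vertex `n + 1` and then by means of `n + 2`. -/
lemma exists_extension_coneFaces {B : SSet.{u}} [SSet.Quasicategory B]
    (f : (ofFaces.{u} (coneFaces n) : SSet) ⟶ B) :
    ∃ g : (ofFaces.{u} (missingFaces n (n + 1)) : SSet) ⟶ B,
      SSet.Subcomplex.homOfLE (ofFaces_mono (coneFaces_le.trans sup_avoidingFaces_le)) ≫ g = f := by
  obtain ⟨g, hg⟩ := exists_extension_ofFaces ⟨n + 1, by omega⟩ (coneFaces n)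
    (missingFaces n n ⊔ avoidingFaces n {n + 1, n + 3}) coneFaces_le (fun S hS hS' => by
      have h₁ : ¬ S ∈ boundaryFaces n := fun h => hS' (Or.inl (Or.inl h))
      have h₂ : ¬ S ∈ tailFaces n := fun h => hS' (Or.inl (Or.inr h))
      have h₃ : ¬ (S ∈ missingFaces n (n + 1) ∧ S ∈ avoidingFaces n {n + 3}) :=
        fun h => hS' (Or.inr h)
      obtain ⟨j, hj, hj'⟩ : S ∈ missingFaces n n := hS.resolve_right fun h => h₃
        ⟨sup_avoidingFaces_le (Or.inr h), fun i hi hi' => h i hi (Or.inr hi')⟩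
      have m₃ : ⟨n + 3, by omega⟩ ∈ S := by
        by_contra h
        refine h₃ ⟨⟨j, by omega, hj'⟩, fun i hi hi' => h ?_⟩
        convert hi
        exact hi'.symm
      have m₂ : ⟨n + 2, by omega⟩ ∈ S := by
        by_contra h
        refine h₁ ((mem_boundaryFaces S).2
          ⟨fun i hi hi' => h ?_, j, by omega, fun i hi hi' => hj' ?_⟩)
        all_goals
          convert hi
          omega
      obtain ⟨i, hi, hi'⟩ : ∃ i ∈ S, i.1 < n + 1 := by simpa [mem_tailFaces] using h₂
      have mem (k : Fin (n + 4)) (hk : k ∈ S) (hk' : k.1 ≠ n + 1) : k ∈ S.erase ⟨n + 1, by omega⟩ :=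
        Finset.mem_erase.2 ⟨fun h => hk' congr(($h).1), hk⟩
      refine ⟨Or.inl ⟨j, hj, ?_⟩, ?_, ⟨i, hi, hi'⟩, _, m₂, by simp [Fin.lt_def]⟩
      · simp [Finset.mem_insert, hj', Fin.ext_iff]
        omega
      · rintro ((h | h) | ⟨-, h⟩)
        · exact h.1 _ (mem _ m₂ (by simp)) rfl
        · exact absurd (h _ (mem _ hi (by omega))) (by omega)
        · exact h _ (mem _ m₃ (by simp)) rfl) f
  obtain ⟨g', hg'⟩ := exists_extension_ofFaces ⟨n + 2, by omega⟩ _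
    (missingFaces n (n + 1)) sup_avoidingFaces_le (fun S hS hS' => by
      have h₁ : ¬ S ∈ missingFaces n n := fun h => hS' (Or.inl h)
      have h₂ : ¬ S ∈ avoidingFaces n {n + 1, n + 3} := fun h => hS' (Or.inr h)
      obtain ⟨j, hj, hj'⟩ := hS
      simp only [mem_missingFaces, mem_avoidingFaces] at h₁ h₂
      push Not at h₁ h₂
      have e : j.1 = n + 1 := by
        by_contra
        exact hj' (h₁ j (by omega))
      obtain ⟨i, hi, hi'⟩ := h₂
      have hi₃ : i.1 = n + 3 := hi'.resolve_left fun h => hj' (by convert hi; omega)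
      refine ⟨⟨j, hj, ?_⟩, ?_, ⟨0, h₁ 0 (by simp), by simp [Fin.lt_def]⟩, i, hi, by
        simp [Fin.lt_def]; omega⟩
      · simp [Finset.mem_insert, hj', Fin.ext_iff]
        omega
      · rintro (⟨k, hk, hk'⟩ | h)
        · refine hk' (Finset.mem_erase.2 ⟨?_, h₁ k hk⟩)
          simp [Fin.ext_iff]
          omega
        · refine h i (Finset.mem_erase.2 ⟨?_, hi⟩) (by simp; omega)
          simp [Fin.ext_iff]
          omega) g
  exact ⟨g', by rw [← hg, ← hg']; rfl⟩

/-- The map from `[n + 1]` to `[n + 3]` which is the inclusion except that it sends `n + 1` to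
`n + 3`. -/
def skipTail (n : ℕ) : Fin (n + 2) →o Fin (n + 4) where
  toFun i := ⟨if i.1 = n + 1 then n + 3 else i, by split <;> omega⟩
  monotone' i j h := by
    have : i.1 ≤ j.1 := h
    simp only [Fin.mk_le_mk]
    split <;> split <;> omega

lemma collapseTail_skipTail (i : Fin (n + 2)) : collapseTail n (skipTail n i) = i := by
  apply Fin.ext
  change min (if i.1 = n + 1 then n + 3 else i.1) (n + 1) = i.1
  split <;> omega

lemma skipTail_ne (i : Fin (n + 2)) : (skipTail n i).1 ≠ n + 1 ∧ (skipTail n i).1 ≠ n + 2 := by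
  change (if i.1 = n + 1 then n + 3 else i.1) ≠ n + 1 ∧
    (if i.1 = n + 1 then n + 3 else i.1) ≠ n + 2
  split <;> omega

lemma mem_boundary_iff_support {N : ℕ} {e : SimplexCategoryᵒᵖ} (z : (Δ[N] : SSet.{u}).obj e) :
    z ∈ (SSet.boundary.{u} N).obj e ↔ ∃ j, j ∉ support z := by
  have h := SSet.mem_boundary_iff_notMem_range (d := e.unop.len) z
  refine h.trans (exists_congr fun j => not_congr ?_)
  exact (mem_support z j).symm

lemma mem_boundaryFaces_iff {e : SimplexCategoryᵒᵖ} (z : (Δ[n + 3] : SSet.{u}).obj e) :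
    support z ∈ boundaryFaces n ↔ (∀ i ∈ support z, i.1 ≠ n + 2) ∧
      (SSet.stdSimplex.{u}.map (SimplexCategory.mkHom (collapseTail n))).app e z ∈
        (SSet.boundary.{u} (n + 1)).obj e := by
  refine and_congr_right fun _ => ?_
  rw [mem_boundary_iff_support, support_map_app]
  simp

/-- If a terminal vertex `t` of a quasi-category admits a retraction onto a vertex `x`, in the
sense of a triangle with vertices `x`, `t`, `x` whose edge from `x` to `x` is degenerate, then
`x` is terminal.

A sphere `s` on the vertices `0`, ..., `n + 1` which ends at `x` is combined with the triangle to
a map on a subcomplex of `Δ[n + 3]`, where the vertices `n + 1`, `n + 2`, `n + 3` stand for `x`,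
`t`, `x`. The map extends to the faces with last vertex `n + 2`, because `t` is terminal, and then
along inner horns to the face which omits `n + 1` and `n + 2`. On the latter it is a filler of
`s`. -/
lemma IsTerminalVertex.of_retract {B : SSet.{u}} [SSet.Quasicategory B] {x : B _⦋0⦌}
    (σ : Δ[2] ⟶ B) (hσ : SSet.stdSimplex.{u}.δ 1 ≫ σ = SSet.const x)
    (ht : IsTerminalVertex B (σ.app _ (SSet.stdSimplex.obj₀Equiv.symm 1))) :
    IsTerminalVertex B x := by
  intro n s hs
  let f₁ : (ofFaces.{u} (boundaryFaces n) : SSet) ⟶ B :=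
    SSet.Subcomplex.lift ((ofFaces _).ι ≫ SSet.stdSimplex.{u}.map
      (SimplexCategory.mkHom (collapseTail n))) (by
        rintro e _ ⟨z, rfl⟩
        exact ((mem_boundaryFaces_iff z.1).1 z.2).2) ≫ s
  let f₂ : (ofFaces.{u} (tailFaces n) : SSet) ⟶ B :=
    (ofFaces _).ι ≫ SSet.stdSimplex.{u}.map (SimplexCategory.mkHom (tailMap n)) ≫ σ
  have sq : SSet.Subcomplex.BicartSq (ofFaces.{u} (boundaryFaces n ⊓ tailFaces n))
    (ofFaces (boundaryFaces n)) (ofFaces (tailFaces n))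
    (ofFaces (boundaryFaces n ⊔ tailFaces n)) := ⟨rfl, rfl⟩
  -- the two maps agree on the edge from `n + 1` to `n + 3`, where both are constant at `x`
  have w : SSet.Subcomplex.homOfLE sq.le₁₂ ≫ f₁ = SSet.Subcomplex.homOfLE sq.le₁₃ ≫ f₂ := by
    ext e ⟨z, hz₁, hz₂⟩
    have h₁ (j) : (collapseTail n (SSet.stdSimplex.asOrderHom z j)) = Fin.last (n + 1) := by
      have := hz₂ _ ((mem_support z _).2 ⟨j, rfl⟩)
      exact Fin.ext (min_eq_right this)
    have e₁ : (⟨_, ((mem_boundaryFaces_iff z).1 hz₁).2⟩ : (∂Δ[n + 1] : SSet.{u}).obj e) =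
        (∂Δ[n + 1] : SSet.{u}).map (e.unop.const ⦋0⦌ 0).op (boundaryLast n) :=
      Subtype.ext (SSet.stdSimplex.ext (d := e.unop.len) _ _ h₁)
    -- the tail takes the values `0` and `2` only, and so it factors through the face `δ 1`
    let ε : Fin (n + 4) →o Fin 2 :=
      { toFun := fun i => if i.1 ≤ n + 2 then 0 else 1
        monotone' := fun i j h => by
          have : i.1 ≤ j.1 := h
          dsimp only
          split <;> split <;> omega }
    have h₂ (j) : tailMap n (SSet.stdSimplex.asOrderHom z j) =
        (1 : Fin 3).succAbove (ε (SSet.stdSimplex.asOrderHom z j)) := by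
      have h₃ := hz₂ _ ((mem_support z _).2 ⟨j, rfl⟩)
      have h₄ := hz₁.1 _ ((mem_support z _).2 ⟨j, rfl⟩)
      generalize SSet.stdSimplex.asOrderHom z j = i at h₃ h₄ ⊢
      apply Fin.ext
      change i.1 - (n + 1) = ((1 : Fin 3).succAbove (if i.1 ≤ n + 2 then 0 else 1)).1
      split
      · change _ = 0
        omega
      · change _ = 2
        omega
    have e₂ : (SSet.stdSimplex.{u}.map (SimplexCategory.mkHom (tailMap n))).app e z =
        (SSet.stdSimplex.{u}.δ 1).app e
          ((SSet.stdSimplex.{u}.map (SimplexCategory.mkHom ε)).app e z) :=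
      SSet.stdSimplex.ext (d := e.unop.len) _ _ h₂
    refine (congrArg (s.app e) e₁).trans (Eq.trans ?_ (congrArg (σ.app e) e₂).symm)
    refine Eq.trans congr($(s.naturality (e.unop.const ⦋0⦌ 0).op) (boundaryLast n)) ?_
    refine (congrArg (B.map _) hs).trans ?_
    exact congr($(hσ).app e ((SSet.stdSimplex.{u}.map (SimplexCategory.mkHom ε)).app e z)).symm
  let f₀ := sq.isPushout.desc f₁ f₂ w
  have hv : Function.Surjective ((SSet.Subcomplex.homOfLE (ofFaces_mono.{u}
      (show boundaryFaces n ⊔ tailFaces n ≤ coneFaces n from le_sup_left))).app (op ⦋0⦌)) := by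
    rintro ⟨v, hv⟩
    suffices support v ∈ boundaryFaces n ⊔ tailFaces n from ⟨⟨v, this⟩, rfl⟩
    have h (i) (hi : i ∈ support v) : i = SSet.stdSimplex.asOrderHom v 0 := by
      obtain ⟨j, rfl⟩ := (mem_support v i).1 hi
      rw [Subsingleton.elim (α := Fin 1) j 0]
    by_cases h' : n + 1 ≤ (SSet.stdSimplex.asOrderHom v 0).1
    · refine Or.inr fun i hi => ?_
      rwa [h i hi]
    · refine Or.inl ((mem_boundaryFaces _).2 ⟨fun i hi => ?_, n + 1, le_rfl, fun i hi => ?_⟩)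
      all_goals
        rw [h i hi]
        omega
  -- the faces to be added have last vertex `n + 2`, which is sent to the terminal vertex
  have hf (d : ℕ) (y : (ofFaces.{u} (coneFaces n) : SSet) _⦋d + 1⦌)
      (hy : y ∉ Set.range ((SSet.Subcomplex.homOfLE (ofFaces_mono.{u}
        (show boundaryFaces n ⊔ tailFaces n ≤ coneFaces n from le_sup_left))).app _))
      (p : (ofFaces.{u} (boundaryFaces n ⊔ tailFaces n) : SSet) _⦋0⦌)
      (hp : (SSet.Subcomplex.homOfLE (ofFaces_mono.{u} le_sup_left)).app _ p = lastVertex y) :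
      IsTerminalVertex B (f₀.app _ p) := by
    obtain ⟨y, hy'⟩ := y
    have hy₁ : support y ∉ boundaryFaces n ⊔ tailFaces n := fun h => hy ⟨⟨y, h⟩, rfl⟩
    obtain ⟨h₁, h₂⟩ : support y ∈ missingFaces n (n + 1) ∧ support y ∈ avoidingFaces n {n + 3} :=
      hy'.resolve_left hy₁
    have h₃ := (missingFaces_inf_le _ h₁ h₂).resolve_left fun h => hy₁ (Or.inl h)
    have h₄ : SSet.stdSimplex.asOrderHom y (Fin.last (d + 1)) = ⟨n + 2, by omega⟩ := by
      obtain ⟨j, hj⟩ := (mem_support y _).1 h₃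
      have h₅ : _ ≤ SSet.stdSimplex.asOrderHom y (Fin.last (d + 1)) :=
        (SSet.stdSimplex.asOrderHom y).monotone (Fin.le_last j)
      have h₆ := h₂ _ ((mem_support y _).2 ⟨Fin.last (d + 1), rfl⟩)
      rw [hj, Fin.le_def] at h₅
      simp at h₅ h₆
      apply Fin.ext
      simp
      omega
    have hp₁ : p.1 = SSet.stdSimplex.obj₀Equiv.symm ⟨n + 2, by omega⟩ :=
      congr(($hp).1).trans (SSet.stdSimplex.ext _ _ fun _ => h₄)
    have hp₂ : support p.1 ∈ tailFaces n := by
      intro i hi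
      obtain ⟨j, rfl⟩ := (mem_support p.1 i).1 hi
      rw [hp₁]
      exact Nat.le_succ (n + 1)
    have e₁ : f₀.app _ p = f₂.app _ ⟨p.1, hp₂⟩ :=
      congr($(sq.isPushout.inr_desc f₁ f₂ w).app _ ⟨p.1, hp₂⟩)
    have e₂ : (SSet.stdSimplex.{u}.map (SimplexCategory.mkHom (tailMap n))).app _ p.1 =
        SSet.stdSimplex.obj₀Equiv.symm 1 := by
      rw [hp₁]
      refine SSet.stdSimplex.ext _ _ fun _ => Fin.ext ?_
      change n + 2 - (n + 1) = 1
      omega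
    exact (congrArg (IsTerminalVertex B) (e₁.trans (congrArg (σ.app _) e₂))).mpr ht
  obtain ⟨f, hf'⟩ := exists_extension (SSet.Subcomplex.homOfLE (ofFaces_mono.{u}
    (show boundaryFaces n ⊔ tailFaces n ≤ coneFaces n from le_sup_left))) f₀ hv hf
  obtain ⟨g, hg⟩ := exists_extension_coneFaces f
  refine ⟨SSet.Subcomplex.lift (SSet.stdSimplex.{u}.map (SimplexCategory.mkHom (skipTail n))) ?_ ≫
    g, ?_⟩
  · rintro e _ ⟨z, rfl⟩
    refine ⟨⟨n + 1, by omega⟩, le_rfl, ?_⟩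
    rw [support_map_app]
    intro h
    obtain ⟨i, -, hi⟩ := Finset.mem_image.1 h
    exact (skipTail_ne i).1 congr(($hi).1)
  · ext e ⟨z, hz⟩
    have e₁ : (SSet.stdSimplex.{u}.map (SimplexCategory.mkHom (collapseTail n))).app e
        ((SSet.stdSimplex.{u}.map (SimplexCategory.mkHom (skipTail n))).app e z) = z :=
      SSet.stdSimplex.ext (d := e.unop.len) _ _ fun j => collapseTail_skipTail _
    have hz' : support ((SSet.stdSimplex.{u}.map (SimplexCategory.mkHom (skipTail n))).app e z) ∈
        boundaryFaces n := by
      refine (mem_boundaryFaces_iff _).2 ⟨fun i hi => ?_, e₁.symm ▸ hz⟩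
      rw [support_map_app] at hi
      obtain ⟨i, -, rfl⟩ := Finset.mem_image.1 hi
      exact (skipTail_ne i).2
    have e₂ := congr($(hg).app e ⟨_, le_sup_left (a := boundaryFaces n ⊔ tailFaces n)
      (Or.inl hz')⟩)
    have e₃ := congr($(hf').app e ⟨_, Or.inl hz'⟩)
    have e₄ := congr($(sq.isPushout.inl_desc f₁ f₂ w).app e ⟨_, hz'⟩)
    exact e₂.trans (e₃.trans (e₄.trans (congrArg (s.app e) (Subtype.ext e₁))))

end Retract

/-! ### Components of weighted limits preserve terminal vertices -/

lemma map_const_zero_apply (B : SSet.{u}) (x : B _⦋0⦌) :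
    B.map (SimplexCategory.const ⦋0⦌ ⦋0⦌ 0).op x = x := by
  have h : SimplexCategory.const ⦋0⦌ ⦋0⦌ 0 = 𝟙 _ := Subsingleton.elim _ _
  rw [h]
  exact B.map_id_apply _ x

/-- The faces of `Δ[2]` on which the triangle of a retraction is prescribed: the edge from `0` to
`2` with its vertices, and the vertex `1`. -/
def retractFaces : LowerSet (Finset (Fin 3)) where
  carrier := {S | 1 ∈ S → S ⊆ {1}}
  lower' _ _ h hS h₁ := h.trans (hS (h h₁))

/-- Two terminal vertices are retracts of each other. The edge from `0` to `2` of the triangle is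
prescribed to be degenerate, and all the other simplices end at a terminal vertex. -/
lemma exists_retract {B : SSet.{u}} {x t : B _⦋0⦌} (hx : IsTerminalVertex B x)
    (ht : IsTerminalVertex B t) :
    ∃ σ : Δ[2] ⟶ B, SSet.stdSimplex.{u}.δ 1 ≫ σ = SSet.const x ∧
      σ.app _ (SSet.stdSimplex.obj₀Equiv.symm 1) = t := by
  classical
  let φ {e : SimplexCategoryᵒᵖ} (z : (Δ[2] : SSet.{u}).obj e) : B _⦋0⦌ :=
    if 1 ∈ support z then t else x
  have hφ {e : SimplexCategoryᵒᵖ} (z : (Δ[2] : SSet.{u}).obj e) : IsTerminalVertex B (φ z) := by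
    dsimp only [φ]
    split <;> assumption
  let f : (ofFaces.{u} retractFaces : SSet) ⟶ B :=
    { app := fun e => ↾fun z => B.map (e.unop.const ⦋0⦌ 0).op (φ z.1)
      naturality := fun e e' α => by
        refine ConcreteCategory.hom_ext _ _ fun z => ?_
        have h : φ (Δ[2].map α z.1) = φ z.1 := by
          have h₁ : 1 ∈ support (Δ[2].map α z.1) ↔ 1 ∈ support z.1 := by
            refine ⟨fun h => support_map_subset _ _ h, fun h => ?_⟩
            have h₂ : SSet.stdSimplex.asOrderHom (Δ[2].map α z.1) 0 ∈ support z.1 :=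
              support_map_subset _ _ ((mem_support _ _).2 ⟨0, rfl⟩)
            rw [← Finset.mem_singleton.1 (z.2 h h₂)]
            exact (mem_support _ _).2 ⟨0, rfl⟩
          simp only [φ, h₁]
        refine (congrArg (B.map (e'.unop.const ⦋0⦌ 0).op) h).trans ?_
        exact (B.map_comp_apply (e.unop.const ⦋0⦌ 0).op α (φ z.1)) }
  have f_vertex (z : (ofFaces.{u} retractFaces : SSet) _⦋0⦌) : f.app _ z = φ z.1 := by
    exact map_const_zero_apply B _
  obtain ⟨σ, hσ⟩ := exists_extension (ofFaces.{u} retractFaces).ι f (fun v => by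
    refine ⟨⟨v, fun h i hi => ?_⟩, rfl⟩
    obtain ⟨j, hj⟩ := (mem_support _ _).1 h
    obtain ⟨j', rfl⟩ := (mem_support _ _).1 hi
    rw [Finset.mem_singleton, ← hj, Subsingleton.elim (α := Fin 1) j j']) (fun n z _ p _ => by
    rw [f_vertex]
    exact hφ _)
  refine ⟨σ, ?_, ?_⟩
  · ext e z
    have h : 1 ∉ support ((SSet.stdSimplex.{u}.δ 1).app e z) := by
      intro h
      obtain ⟨j, hj⟩ := (mem_support _ _).1 h
      exact Fin.succAbove_ne _ _ hj
    have h' := congr($(hσ).app e ⟨_, fun h' => (h h').elim⟩)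
    refine h'.trans ?_
    change B.map _ (φ _) = B.map _ x
    rw [show φ _ = x from if_neg h]
  · have h : 1 ∈ support (SSet.stdSimplex.obj₀Equiv.{u}.symm (1 : Fin 3)) :=
      (mem_support _ _).2 ⟨0, rfl⟩
    have h' := congr($(hσ).app _ ⟨SSet.stdSimplex.obj₀Equiv.{u}.symm (1 : Fin 3), fun _ i hi => by
      obtain ⟨j, rfl⟩ := (mem_support _ _).1 hi
      exact Finset.mem_singleton.2 rfl⟩)
    exact h'.trans ((f_vertex _).trans (if_pos h))

namespace Weight

variable {W E : Weight A} {L : SSet.{u}} {l : tensor L W ⟶ E}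

/-- The components of a weighted limit of quasi-categories with terminal vertices preserve terminal
vertices: the limit has a terminal vertex `t` with terminal components, any terminal vertex `x` is
a retract of `t`, and so the components of `x` are retracts of those of `t`. -/
lemma IsUniversal.isTerminalVertex_app (hW : W.IsProjectiveCofibrant) (hE : E.PreservesTerminal)
    (hE' : ∀ a, ∃ t, IsTerminalVertex (E.obj a) t) (hE'' : ∀ a, SSet.Quasicategory (E.obj a))
    (hl : IsUniversal l) {x : L _⦋0⦌} (hx : IsTerminalVertex L x) (a : A) (w : W.obj a _⦋0⦌) :
    IsTerminalVertex (E.obj a) ((l.app a).app _ (x, w)) := by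
  obtain ⟨t, ht⟩ := hl.exists_vertex hW hE hE'
  obtain ⟨σ, hσ, hσ'⟩ := exists_retract hx (hl.isTerminalVertex hW hE t ht)
  have := hE'' a
  refine IsTerminalVertex.of_retract
    (CartesianMonoidalCategory.lift σ (SSet.const w) ≫ l.app a) ?_ ?_
  · ext e z
    have h₁ := congr($(hσ).app e z)
    refine (congrArg (fun y => (l.app a).app e (y, (W.obj a).map (e.unop.const ⦋0⦌ 0).op w))
      h₁).trans ?_
    exact congr($((l.app a).naturality (e.unop.const ⦋0⦌ 0).op) (x, w))
  · have e : (CartesianMonoidalCategory.lift σ (SSet.const w) ≫ l.app a).app _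
        (SSet.stdSimplex.obj₀Equiv.symm 1) = (l.app a).app _ (t, w) := by
      refine (congrArg (fun y => (l.app a).app _
        (y, (W.obj a).map (SimplexCategory.const _ ⦋0⦌ 0).op w)) hσ').trans ?_
      exact congrArg (fun y => (l.app a).app _ (t, y)) (map_const_zero_apply _ w)
    rw [e]
    exact ht a w

end Weight

/-! ### Limit cones in the simplicial category of quasi-categories with terminal objects -/

lemma mapVertex_app {B C : SSet.{u}} {n : SimplexCategoryᵒᵖ} (s : (Map B C).obj n)
    (i : n ⟶ op ⦋0⦌) (t : B _⦋0⦌) : (mapVertex s i).app _ t = s.app _ i t := by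
  obtain ⟨f, hf⟩ := (SimplicialCategory.homEquiv' B C).surjective ((Map B C).map i s)
  have h : mapVertex s i = f := by
    rw [mapVertex, ← hf, Equiv.symm_apply_apply]
  have h' : ((Map B C).map i s).app _ (𝟙 _) t = s.app _ i t :=
    congr(s.app _ $(Category.comp_id i) t)
  rw [h, ← h', ← hf]
  rfl

lemma mem_terminalMap {B C : SSet.{u}} {n : SimplexCategoryᵒᵖ} (s : (Map B C).obj n) :
    s ∈ (terminalMap B C).obj n ↔ ∀ (i : n ⟶ op ⦋0⦌) (t : B _⦋0⦌), IsTerminalVertex B t →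
      IsTerminalVertex C (s.app _ i t) := by
  refine forall_congr' fun i => forall_congr' fun t => imp_congr_right fun _ => ?_
  rw [mapVertex_app]

section

variable (D : EnrichedFunctor SSet.{u} A QCatTerminal.{u})

lemma diagramWeight_preservesTerminal :
    (diagramWeight (D.comp SSet.{u} QCatTerminal.incl.{u})).PreservesTerminal :=
  fun a b x hx k => (mem_terminalMap _).1 ((D.map a b).app _ k).2 (𝟙 _) x hx

variable {D} {W : Weight A} {L : SSet.QCat.{u}}
  {c : WeightedCone W (D.comp SSet.{u} QCatTerminal.incl.{u}) L}

/-- The components of a limit cone over a diagram of quasi-categories with terminal vertices are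
arrows of `QCatTerminal`. -/
lemma WeightedCone.IsLimit.app_mem_terminalMap (hW : W.IsProjectiveCofibrant) (hc : c.IsLimit)
    (a : A) {n : SimplexCategoryᵒᵖ} (w : (W.obj a).obj n) :
    (c.app a).app n w ∈ (terminalMap L.obj (D.obj a).toQCat.obj).obj n := by
  refine (mem_terminalMap _).2 fun i t ht => ?_
  have h := Weight.IsUniversal.isTerminalVertex_app hW (diagramWeight_preservesTerminal D)
    (fun a => (D.obj a).exists_terminal) (fun a => (D.obj a).toQCat.property)
    ((isLimit_iff_isUniversal c).1 hc) ht a ((W.obj a).map i w)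
  have e : ((coneEquiv c).app a).app _ (t, (W.obj a).map i w) = ((c.app a).app n w).app _ i t := by
    refine (coneEquiv_apply c a t _).trans ?_
    refine congr($((c.app a).naturality i) w |>.app _ (𝟙 _) t).trans ?_
    exact congr(((c.app a).app n w).app _ $(Category.comp_id i) t)
  exact (congrArg (IsTerminalVertex _) e).mp h

/-- The lift to `QCatTerminal` of a limit cone of quasi-categories. -/
def WeightedCone.IsLimit.lift (hW : W.IsProjectiveCofibrant) (hc : c.IsLimit)
    (hL : ∃ t : L.obj _⦋0⦌, IsTerminalVertex L.obj t) : WeightedCone W D ⟨L, hL⟩ where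
  app a := SSet.Subcomplex.lift (c.app a) (by
    rintro n _ ⟨w, rfl⟩
    exact hc.app_mem_terminalMap hW a w)
  naturality a b := by
    apply (cancel_mono (terminalMap L.obj (D.obj b).toQCat.obj).ι).1
    exact c.naturality a b

/-- Maps into `Map K L` whose composites with the limit cone take values in functors which preserve
terminal vertices do so themselves, since vertices of `L` with terminal components are terminal. -/
lemma WeightedCone.IsLimit.isLimit_lift (hW : W.IsProjectiveCofibrant) (hc : c.IsLimit)
    (hL : ∃ t : L.obj _⦋0⦌, IsTerminalVertex L.obj t) : (hc.lift hW hL).IsLimit := by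
  intro K X s
  obtain ⟨g, hg, hu⟩ := hc K.toQCat X (s.map QCatTerminal.incl.{u})
  have hgm {n : SimplexCategoryᵒᵖ} (x : X.obj n) :
      g.app n x ∈ (terminalMap K.toQCat.obj L.obj).obj n := by
    refine (mem_terminalMap _).2 fun i t ht => ?_
    refine Weight.IsUniversal.isTerminalVertex hW (diagramWeight_preservesTerminal D)
      ((isLimit_iff_isUniversal c).1 hc) _ fun a w => ?_
    have h := (mem_terminalMap _).1 ((s.app a).app _ (X.map i x, w)).2 (𝟙 _) t ht
    have e₁ : (g.app _ (X.map i x)).app _ (𝟙 _) t = (g.app n x).app _ i t := by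
      refine congr($(g.naturality i) x |>.app _ (𝟙 _) t).trans ?_
      exact congr((g.app n x).app _ $(Category.comp_id i) t)
    have e₂ := congr(($(hg a).app _ (X.map i x, w)).app _ (𝟙 _) t)
    have e₃ : ((coneEquiv c).app a).app _ ((g.app n x).app _ i t, w) =
        (((s.app a).app _ (X.map i x, w)).1).app _ (𝟙 _) t :=
      (congrArg (fun y => ((coneEquiv c).app a).app _ (y, w)) e₁.symm).trans e₂
    exact (congrArg (IsTerminalVertex _) e₃).mpr h
  refine ⟨SSet.Subcomplex.lift g (by rintro n _ ⟨x, rfl⟩; exact hgm x), fun a => ?_,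
    fun g' hg' => ?_⟩
  · apply (cancel_mono (terminalMap K.toQCat.obj (D.obj a).toQCat.obj).ι).1
    exact hg a
  · apply (cancel_mono (terminalMap K.toQCat.obj L.obj).ι).1
    exact hu _ fun a => congrArg (· ≫ (terminalMap K.toQCat.obj (D.obj a).toQCat.obj).ι) (hg' a)

end

end SimplicialLimits

end

theorem mainTheorem9 {A : Type u} [EnrichedCategory SSet.{u} A]
    (W : SimplicialLimits.Weight A) (hW : W.IsProjectiveCofibrant)
    (D : EnrichedFunctor SSet.{u} A SimplicialLimits.QCatTerminal.{u}) :
    (∃ (L : SSet.QCat.{u})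
      (c : SimplicialLimits.WeightedCone W
        (D.comp SSet.{u} SimplicialLimits.QCatTerminal.incl.{u}) L), c.IsLimit) ∧
    ∀ (L : SSet.QCat.{u})
      (c : SimplicialLimits.WeightedCone W
        (D.comp SSet.{u} SimplicialLimits.QCatTerminal.incl.{u}) L), c.IsLimit →
      ∃ (hL : ∃ t : L.obj _⦋0⦌,
          SimplicialLimits.IsTerminalVertex L.obj t)
        (c' : SimplicialLimits.WeightedCone W D ⟨L, hL⟩),
        c'.map SimplicialLimits.QCatTerminal.incl.{u} = c ∧ c'.IsLimit := by
  refine ⟨?_, fun L c hc => ?_⟩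
  · have hl := SimplicialLimits.Weight.limitπ_isUniversal W
      (SimplicialLimits.diagramWeight (D.comp SSet.{u} SimplicialLimits.QCatTerminal.incl.{u}))
    let L : SSet.QCat.{u} := ⟨_, hl.quasicategory hW fun a => (D.obj a).toQCat.property⟩
    let c : SimplicialLimits.WeightedCone W
        (D.comp SSet.{u} SimplicialLimits.QCatTerminal.incl.{u}) L :=
      SimplicialLimits.coneEquiv.symm (SimplicialLimits.Weight.limitπ W _)
    refine ⟨L, c, (SimplicialLimits.isLimit_iff_isUniversal c).2 ?_⟩
    rw [Equiv.apply_symm_apply]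
    exact hl
  · have hl := (SimplicialLimits.isLimit_iff_isUniversal c).1 hc
    obtain ⟨t, ht⟩ := hl.exists_vertex hW (SimplicialLimits.diagramWeight_preservesTerminal D)
      fun a => (D.obj a).exists_terminal
    have hL := hl.isTerminalVertex hW (SimplicialLimits.diagramWeight_preservesTerminal D) t ht
    exact ⟨⟨t, hL⟩, hc.lift hW _, rfl, hc.isLimit_lift hW _⟩
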